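/- Let $a\in\mathbb R\setminus\{0\}$, $\sigma\in\{1,-1\}$, $J=\mathrm{diag}(1,\sigma)$, and let $\rho_n(s)\in\mathbb R$, $q_n(s)\in\mathbb C$ $(n\in\mathbb Z,\ s\in\mathbb R)$, differentiable in $s$, solve the semi-discrete coupled dispersionless system $$(q_{n+1}-q_n)_s=\tfrac12a\rho_n(q_{n+1}+q_n),\qquad (a\rho_n)_s+\tfrac{\sigma}{2}\left(|q_{n+1}|^2-|q_n|^2\right)=0,$$ the compatibility condition of the Lax pair $\Psi_{n+1}=U_n\Psi_n$, $\Psi_{n,s}=V_n\Psi_n$ with spectral parameter $\lambda$, where $$U_n(\rho,q;\lambda)=\begin{bmatrix}1-\frac{\mathrm ia\rho_n}{\lambda}&-\sigma\frac{q_{n+1}^*-q_n^*}{\lambda}\\ \frac{q_{n+1}-q_n}{\lambda}&1+\frac{\mathrm ia\rho_n}{\lambda}\end{bmatrix},\qquad V_n(q;\lambda)=\frac{\mathrm i}{4}\lambda\begin{bmatrix}1&0\\0&-1\end{bmatrix}+\frac{\mathrm i}{2}\begin{bmatrix}0&\sigma q_n^*\\ q_n&0\end{bmatrix}.$$ Here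 $*$ is complex conjugation, $\dagger$ is the conjugate transpose, $\langle u|J|v\rangle=u^\dagger Jv$, $E$ is the shift $n\mapsto n+1$, and for a zero-free differentiable function $f$ of $s$ we write $\ln_s f=f_s/f$ and $\ln_{ss}f=(f_s/f)_s$. (i) ($N$-fold case.) Let $\lambda_1,\dots,\lambda_N\in\mathbb C$ with $\lambda_i^*\ne\lambda_j$ for all $i,j$, and let $|y_{i}\rangle=|y_{i,n}(s)\rangle\in\mathbb C^2$ solve the Lax pair at $\lambda=\lambda_i$. Put $$Y=\left[|y_1\rangle,\dots,|y_N\rangle\right],\quad M_n=\left(\frac{\langle y_i|J|y_j\rangle}{\lambda_i^*-\lambda_j}\right)_{1\le i,j\le N},\quad D=\mathrm{diag}(\lambda-\lambda_1^*,\dots,\lambda-\lambda_N^*),\quad T_{n,N}=I+YM_n^{-1}D^{-1}Y^\dagger J.$$ (ii) (Generalized case.) Let $\lambda_1,\dots,\lambda_r\in\mathbb C$ with $\lambda_i^*\ne\lambda_j$ for all $i,j$, let $\alpha_1,\dots,\alpha_r\in\mathbb C$, let $n_1,\dots,n_r$ be multiplicities with $N=n_1+\dots+n_r$, and for each $i$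 let $|y_i(\lambda)\rangle=|y_{i,n}(s;\lambda)\rangle\in\mathbb C^2$ be a family of solutions of the Lax pair at $\lambda$, defined for $\lambda$ in an open neighbourhood of $\lambda_i$ and holomorphic in $\lambda$ there. Define $|y_i^{[k]}\rangle$, $D_i^{[k]}$ and $M_{ij}^{[k,l]}$ as the Taylor coefficients in $$|y_i(\lambda_i+\alpha_i\epsilon_i)\rangle=\sum_{k\ge0}|y_i^{[k]}\rangle\epsilon_i^k,\qquad \frac{1}{\lambda-\lambda_i^*-\alpha_i^*\epsilon_i^*}=\sum_{k\ge0}D_i^{[k]}\epsilon_i^{*k},$$ $$\frac{\langle y_i(\lambda_i+\alpha_i\epsilon_i)|J|y_j(\lambda_j+\alpha_j\epsilon_j)\rangle}{\lambda_i^*-\lambda_j+\alpha_i^*\epsilon_i^*-\alpha_j\epsilon_j}=\sum_{k,l\ge1}M_{ij}^{[k,l]}\epsilon_i^{*(k-1)}\epsilon_j^{l-1},$$ where $\epsilon_i^*$ and $\epsilon_j$ are treated as independent variables (also for $i=j$), and put $$Y=\left[|y_1^{[0]}\rangle,\dots,|y_1^{[n_1-1]}\rangle,\dots,|y_r^{[0]}\rangle,\dots,|y_r^{[n_r-1]}\rangle\right],\quad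 M_n=(M_{ij})_{1\le i,j\le r},\quad M_{ij}=\left(M_{ij}^{[k,l]}\right)_{1\le k\le n_i,\,1\le l\le n_j},$$ $$D^{-1}:=\mathrm{diag}(\mathcal D_1,\dots,\mathcal D_r),\quad \mathcal D_i=\begin{bmatrix}D_i^{[0]}&0&0\\ \vdots&\ddots&0\\ D_i^{[n_i-1]}&\cdots&D_i^{[0]}\end{bmatrix},\quad T_{n,N}=I+YM_n^{-1}D^{-1}Y^\dagger J.$$ In both cases let $G_n=\begin{bmatrix}M_n&Y_1^\dagger\\-Y_2&0\end{bmatrix}$, where $Y_k$ is the $k$-th row of $Y$. All statements below are at points $(n,s)$ where $\det M_n\neq0$ (and also $\det M_{n+1}\ne0$ for those that involve the index $n+1$). Then $T_{n,N}$ is a Darboux matrix: there are a real function $\rho_n^{[N]}$ and a complex function $q_n^{[N]}$ such that, for all $\lambda\neq0$ different from all $\lambda_i^*$, $$T_{n+1,N}\,U_n(\rho,q;\lambda)=U_n(\rho^{[N]},q^{[N]};\lambda)\,T_{n,N},\qquad (T_{n,N})_s+T_{n,N}V_n(q;\lambda)=V_n(q^{[N]};\lambda)\,T_{n,N},$$ so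 that $T_{n,N}\Psi_n$ solves the Lax pair with $(\rho^{[N]},q^{[N]})$ whenever $\Psi_n$ solves the one with $(\rho,q)$; $(\rho^{[N]},q^{[N]})$ again solves the semi-discrete system; and the Bäcklund formulas hold: $$\rho_n^{[N]}=\rho_n-\frac2a\ln_s\left(\frac{E(\det M_n)}{\det M_n}\right),\qquad q_n^{[N]}=q_n+\frac{\det G_n}{\det M_n},\qquad |q_n^{[N]}|^2=|q_n|^2+4\sigma\ln_{ss}(\det M_n).$$ Moreover, the generalized Darboux matrix is a limit of $N$-fold ones: at every $(n,s)$ with $\det M_n\ne0$ in case (ii), and for every $\lambda\notin\{\lambda_1^*,\dots,\lambda_r^*\}$, the $N$-fold Darboux matrix of case (i) formed with the spectral points $\lambda_i+\alpha_i\epsilon_{i,k}$ and the vectors $|y_i(\lambda_i+\alpha_i\epsilon_{i,k})\rangle$ $(1\le i\le r,\ 1\le k\le n_i)$ has invertible $M$-matrix and tends to the generalized $T_{n,N}$, as all $\epsilon_{i,k}\to0$ with $\epsilon_{i,1},\dots,\epsilon_{i,n_i}$ pairwise distinct for each $i$ (the invertibility holding for all sufficiently small such $\epsilon$). -/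

import Mathlib

open Matrix Filter Topology

noncomputable section

namespace SemiDiscreteCSP

/-- `J = diag(1, σ)`. -/
def J (σ : ℝ) : Matrix (Fin 2) (Fin 2) ℂ := !![1, 0; 0, (σ : ℂ)]

/-- The indefinite product `⟨u|J|v⟩ = u† J v`. -/
def bracket (σ : ℝ) (u v : Fin 2 → ℂ) : ℂ := star u ⬝ᵥ (J σ *ᵥ v)

/-- The spatial Lax matrix `U_n(ρ, q; z)` at `(n, s)`, with spectral parameter `z`. -/
def laxU (a σ : ℝ) (ρ : ℤ → ℝ → ℝ) (q : ℤ → ℝ → ℂ) (z : ℂ) (n : ℤ) (s : ℝ) :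
    Matrix (Fin 2) (Fin 2) ℂ :=
  !![1 - Complex.I * a * ρ n s / z, -(σ : ℂ) * (star (q (n + 1) s) - star (q n s)) / z;
     (q (n + 1) s - q n s) / z, 1 + Complex.I * a * ρ n s / z]

/-- The temporal Lax matrix `V_n(q; z) = (i/4) z σ₃ + (i/2) Q_n` at `(n, s)`. -/
def laxV (σ : ℝ) (q : ℤ → ℝ → ℂ) (z : ℂ) (n : ℤ) (s : ℝ) : Matrix (Fin 2) (Fin 2) ℂ :=
  (Complex.I / 4 * z) • !![1, 0; 0, -1] +
    (Complex.I / 2) • !![0, (σ : ℂ) * star (q n s); q n s, 0]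

/-- `Ψ` solves the Lax pair `Ψ_{n+1} = U_n Ψ_n`, `Ψ_{n,s} = V_n Ψ_n` at the spectral
parameter `z`. -/
def IsLaxSolution (a σ : ℝ) (ρ : ℤ → ℝ → ℝ) (q : ℤ → ℝ → ℂ) (z : ℂ)
    (Ψ : ℤ → ℝ → Fin 2 → ℂ) : Prop :=
  (∀ n s, Ψ (n + 1) s = laxU a σ ρ q z n s *ᵥ Ψ n s) ∧
  (∀ n s, HasDerivAt (Ψ n) (laxV σ q z n s *ᵥ Ψ n s) s)

/-- The semi-discrete complex coupled dispersionless system (the compatibility condition of the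
Lax pair), at the point `(n, s)`. -/
def SolvesAt (a σ : ℝ) (ρ : ℤ → ℝ → ℝ) (q : ℤ → ℝ → ℂ) (n : ℤ) (s : ℝ) : Prop :=
  HasDerivAt (fun t => q (n + 1) t - q n t) (a * ρ n s * (q (n + 1) s + q n s) / 2) s ∧
  HasDerivAt (fun t => a * ρ n t) (-(σ / 2) * (‖q (n + 1) s‖ ^ 2 - ‖q n s‖ ^ 2)) s

/-- `T` is a Darboux matrix from the potentials `(ρ, q)` to `(ρN, qN)`: it intertwines the two Lax
pairs and it sends solutions of the old one to solutions of the new one. Here `z` runs over the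
nonzero spectral parameters outside `poles`, and `dM n s ≠ 0` says that `T` is defined at
`(n, s)`. -/
def IsDarbouxMatrix (a σ : ℝ) (ρ : ℤ → ℝ → ℝ) (q : ℤ → ℝ → ℂ) (ρN : ℤ → ℝ → ℝ) (qN : ℤ → ℝ → ℂ)
    (poles : Set ℂ) (dM : ℤ → ℝ → ℂ) (T : ℂ → ℤ → ℝ → Matrix (Fin 2) (Fin 2) ℂ) : Prop :=
  ∀ z : ℂ, z ≠ 0 → z ∉ poles → ∀ (n : ℤ) (s : ℝ), dM n s ≠ 0 →
    (dM (n + 1) s ≠ 0 →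
      T z (n + 1) s * laxU a σ ρ q z n s = laxU a σ ρN qN z n s * T z n s) ∧
    (∀ i j, HasDerivAt (fun t => T z n t i j)
      ((laxV σ qN z n s * T z n s - T z n s * laxV σ q z n s) i j) s) ∧
    (∀ Ψ : ℤ → ℝ → Fin 2 → ℂ, IsLaxSolution a σ ρ q z Ψ →
      (dM (n + 1) s ≠ 0 →
        T z (n + 1) s *ᵥ Ψ (n + 1) s = laxU a σ ρN qN z n s *ᵥ (T z n s *ᵥ Ψ n s)) ∧
      HasDerivAt (fun t => T z n t *ᵥ Ψ n t) (laxV σ qN z n s *ᵥ (T z n s *ᵥ Ψ n s)) s)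

/-- The Bäcklund formulas, with `dM = det M_n` and `dG = det G_n`. For a complex-valued
function `f` without zeros, `ln_s f` is the logarithmic derivative `f_s / f`, and
`ln_ss f = (f_s / f)_s`. -/
def BacklundFormulas (a σ : ℝ) (ρ : ℤ → ℝ → ℝ) (q : ℤ → ℝ → ℂ) (ρN : ℤ → ℝ → ℝ)
    (qN : ℤ → ℝ → ℂ) (dM dG : ℤ → ℝ → ℂ) : Prop :=
  ∀ (n : ℤ) (s : ℝ), dM n s ≠ 0 →
    DifferentiableAt ℝ (dM n) s ∧ DifferentiableAt ℝ (logDeriv (dM n)) s ∧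
    (dM (n + 1) s ≠ 0 →
      (ρN n s : ℂ) = ρ n s - 2 / a * logDeriv (fun t => dM (n + 1) t / dM n t) s) ∧
    qN n s = q n s + dG n s / dM n s ∧
    ((‖qN n s‖ ^ 2 : ℝ) : ℂ) = (‖q n s‖ ^ 2 : ℝ) + 4 * σ * deriv (logDeriv (dM n)) s

/-- The transformed potentials again solve the system, wherever they are defined. -/
def SolvesAgain (a σ : ℝ) (ρN : ℤ → ℝ → ℝ) (qN : ℤ → ℝ → ℂ) (dM : ℤ → ℝ → ℂ) : Prop :=
  ∀ (n : ℤ) (s : ℝ), dM n s ≠ 0 →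
    DifferentiableAt ℝ (qN n) s ∧ (dM (n + 1) s ≠ 0 → SolvesAt a σ ρN qN n s)

/-- `G = [[M, Y₁†], [-Y₂, 0]]`, where `Y₁`, `Y₂` are the rows of the `2 × N` matrix `Y`. -/
def matG {ι : Type*} (Y : Matrix (Fin 2) ι ℂ) (M : Matrix ι ι ℂ) :
    Matrix (ι ⊕ Unit) (ι ⊕ Unit) ℂ :=
  Matrix.fromBlocks M (Matrix.of fun p _ => star (Y 0 p)) (Matrix.of fun _ p => -Y 1 p) 0

section NFold

variable {ι : Type*} [Fintype ι] [DecidableEq ι]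

/-- The matrix `Y = [|y_1⟩, …, |y_N⟩]`. -/
def nfoldY (v : ι → Fin 2 → ℂ) : Matrix (Fin 2) ι ℂ := Matrix.of fun x p => v p x

/-- The matrix `M = (⟨y_i|J|y_j⟩ / (λ_i^* - λ_j))`. -/
def nfoldM (σ : ℝ) (lam : ι → ℂ) (v : ι → Fin 2 → ℂ) : Matrix ι ι ℂ :=
  Matrix.of fun p p' => bracket σ (v p) (v p') / (star (lam p) - lam p')

/-- The `N`-fold Darboux matrix `I + Y M⁻¹ D⁻¹ Y† J`, `D = diag(z - λ_i^*)`, for vectors `v i`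
attached to the spectral points `lam i`. -/
def nfoldT (σ : ℝ) (lam : ι → ℂ) (v : ι → Fin 2 → ℂ) (z : ℂ) : Matrix (Fin 2) (Fin 2) ℂ :=
  1 + nfoldY v * (nfoldM σ lam v)⁻¹ * (Matrix.diagonal fun p => z - star (lam p))⁻¹ *
    (nfoldY v)ᴴ * J σ

end NFold

section Generalized

/-- The coefficient of `ε ^ k` in the Taylor expansion of `f` at `0`. -/
def taylorCoeff (f : ℂ → ℂ) (k : ℕ) : ℂ := iteratedDeriv k f 0 / (k.factorial : ℂ)

variable {r : ℕ}

/-- The columns of the generalized matrices: the `i`-th spectral point occurs `m i` times. -/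
abbrev Idx (m : Fin r → ℕ) : Type := Σ i : Fin r, Fin (m i)

/-- The matrix `Y = [|y_1^[0]⟩, …, |y_1^[m_1 - 1]⟩, …, |y_r^[0]⟩, …, |y_r^[m_r - 1]⟩]`, where
`|y_i^[k]⟩` is the `k`-th Taylor coefficient in `ε` of `|y_i(λ_i + α_i ε)⟩`. -/
def genY (m : Fin r → ℕ) (lam α : Fin r → ℂ) (y : Fin r → ℂ → ℤ → ℝ → Fin 2 → ℂ)
    (n : ℤ) (s : ℝ) : Matrix (Fin 2) (Idx m) ℂ :=
  Matrix.of fun x p => taylorCoeff (fun ε => y p.1 (lam p.1 + α p.1 * ε) n s x) p.2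

/-- The function whose expansion in `μ = ε_i^*` and `ε = ε_j` defines the block `M_ij`; it is
holomorphic in the two independent variables `μ`, `ε` near `0`. -/
def kernelM (σ : ℝ) (lam α : Fin r → ℂ) (y : Fin r → ℂ → ℤ → ℝ → Fin 2 → ℂ)
    (n : ℤ) (s : ℝ) (i j : Fin r) (μ ε : ℂ) : ℂ :=
  bracket σ (y i (lam i + α i * star μ) n s) (y j (lam j + α j * ε) n s) /
    (star (lam i) - lam j + star (α i) * μ - α j * ε)

/-- The block matrix `M = (M_ij)`; the entry of `M_ij` in row `k` and column `l` (counted from `0`)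
is the coefficient of `ε_i^{* k} ε_j^l`. -/
def genM (σ : ℝ) (m : Fin r → ℕ) (lam α : Fin r → ℂ) (y : Fin r → ℂ → ℤ → ℝ → Fin 2 → ℂ)
    (n : ℤ) (s : ℝ) : Matrix (Idx m) (Idx m) ℂ :=
  Matrix.of fun p p' =>
    taylorCoeff (fun μ => taylorCoeff (fun ε => kernelM σ lam α y n s p.1 p'.1 μ ε) p'.2) p.2

/-- The block-diagonal matrix that plays the role of `D⁻¹`: its `i`-th block is the
triangular Toeplitz matrix of the coefficients `D_i^[k]` of `μ ^ k`, `μ = ε_i^*`, in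
`1 / (z - λ_i^* - α_i^* μ)`. It is lower triangular because the rows of `Y†` are ordered
by increasing powers of `ε_i^*`. -/
def genDinv (m : Fin r → ℕ) (lam α : Fin r → ℂ) (z : ℂ) : Matrix (Idx m) (Idx m) ℂ :=
  Matrix.blockDiagonal' fun i => Matrix.of fun k l : Fin (m i) =>
    if (l : ℕ) ≤ k then
      taylorCoeff (fun μ => 1 / (z - star (lam i) - star (α i) * μ)) ((k : ℕ) - l)
    else 0

/-- The generalized Darboux matrix. -/
def genT (σ : ℝ) (m : Fin r → ℕ) (lam α : Fin r → ℂ) (y : Fin r → ℂ → ℤ → ℝ → Fin 2 → ℂ)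
    (z : ℂ) (n : ℤ) (s : ℝ) : Matrix (Fin 2) (Fin 2) ℂ :=
  1 + genY m lam α y n s * (genM σ m lam α y n s)⁻¹ * genDinv m lam α z *
    (genY m lam α y n s)ᴴ * J σ

/-- Split spectral points `λ_i + α_i ε_{i,k}`. -/
def splitLam (m : Fin r → ℕ) (lam α : Fin r → ℂ) (ε : Idx m → ℂ) (p : Idx m) : ℂ :=
  lam p.1 + α p.1 * ε p

/-- The eigenvectors `|y_i(λ_i + α_i ε_{i,k})⟩` at the split spectral points. -/
def splitY (m : Fin r → ℕ) (lam α : Fin r → ℂ) (y : Fin r → ℂ → ℤ → ℝ → Fin 2 → ℂ)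
    (n : ℤ) (s : ℝ) (ε : Idx m → ℂ) (p : Idx m) : Fin 2 → ℂ :=
  y p.1 (splitLam m lam α ε p) n s

/-- The filter `ε → 0` along parameters that are pairwise distinct within each group. -/
def splitFilter (m : Fin r → ℕ) : Filter (Idx m → ℂ) :=
  𝓝[{ε | ∀ i, Function.Injective fun k : Fin (m i) => ε ⟨i, k⟩}] 0

end Generalized

end SemiDiscreteCSP

end

/-! Both cases are one construction. Let a square matrix `Λ` play the role of the spectral
parameter: diagonal in the `N`-fold case, block bidiagonal (`jordan`) in the generalized one. Then
`Y` solves the Lax pair with `Λ` acting from the right, `M` is the solution of the Sylvester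
equation `Λ† M - M Λ = Y† J Y`, and the Darboux matrix is `1 + Y M⁻¹ (z - Λ†)⁻¹ Y† J`. The
assumption `λ_i^* ≠ λ_j` makes the map `X ↦ Λ† X - X Λ` injective. This uniqueness yields everything
needed about `M`: it is skew-Hermitian, and its shift in `n` and derivative in `s` are explicit
(`sylvester_shift`, `hasMatDerivAt_M`). `IsDressing` records these data.

For such data the moments `Y M⁻¹ C Y† J` obey closed shift and derivative identities
(`dressing_shift`, `dressing_deriv`). Taking for `C` the resolvent of `Λ†` gives the two
intertwining relations, and `C = 1` gives the evolution of the residue `R = Y M⁻¹ Y† J`. The new Lax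
coefficients are `A + R_{n+1} - R_n` and `Q + [R, σ₃] / 2`. The symmetry of `M` and the constancy of
`tr R` show that they have Lax form. Jacobi's formula expresses `ln_s det M` affinely through the
entry `R₀₀`, whose derivative is a multiple of `|q^[N]|² - |q|²`. Hence the Bäcklund formulas
follow, and the new potentials solve the system by the same identities.

In the generalized case, multiplying a power series by `λ + α ε` acts on its coefficients as a
bidiagonal matrix, so Taylor coefficients of a holomorphic family of Lax solutions form a dressing
(`gen_isDressing`). Differentiating them in `s` uses Cauchy integrals and a Gronwall bound.

For the limit, Newton interpolation writes the columns `y(λ + α ε_k)` as divided differences times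
an invertible matrix, which conjugates a bidiagonal matrix to the diagonal of split spectral points.
The Darboux matrix does not see this change of basis (`dressing_congr`), divided differences tend to
Taylor coefficients, and the solution of the Sylvester equation depends continuously on its data. -/

noncomputable section

namespace SemiDiscreteCSP

/-! ### Entrywise calculus for matrix functions of a real variable -/

section MatrixCalculus

/-- Entrywise derivative of a matrix-valued function of a real variable. -/
def HasMatDerivAt {m n : Type*} (F : ℝ → Matrix m n ℂ) (F' : Matrix m n ℂ) (s : ℝ) : Prop :=
  ∀ i j, HasDerivAt (fun t => F t i j) (F' i j) s

variable {l m n : Type*}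

namespace HasMatDerivAt

variable {F G : ℝ → Matrix m n ℂ} {F' G' : Matrix m n ℂ} {s : ℝ}

theorem const (A : Matrix m n ℂ) (s : ℝ) : HasMatDerivAt (fun _ => A) 0 s :=
  fun i j => hasDerivAt_const s (A i j)

theorem add (hF : HasMatDerivAt F F' s) (hG : HasMatDerivAt G G' s) :
    HasMatDerivAt (fun t => F t + G t) (F' + G') s :=
  fun i j => (hF i j).add (hG i j)

theorem sub (hF : HasMatDerivAt F F' s) (hG : HasMatDerivAt G G' s) :
    HasMatDerivAt (fun t => F t - G t) (F' - G') s :=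
  fun i j => (hF i j).sub (hG i j)

theorem conjTranspose (hF : HasMatDerivAt F F' s) :
    HasMatDerivAt (fun t => (F t)ᴴ) F'ᴴ s :=
  fun i j => (hF j i).star

theorem mul [Fintype n] {G : ℝ → Matrix n l ℂ} {G' : Matrix n l ℂ}
    (hF : HasMatDerivAt F F' s) (hG : HasMatDerivAt G G' s) :
    HasMatDerivAt (fun t => F t * G t) (F' * G s + F s * G') s := by
  intro i j
  have h := HasDerivAt.fun_sum (u := Finset.univ) fun k _ => (hF i k).mul (hG k j)
  simpa [Matrix.mul_apply, Finset.sum_add_distrib] using h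

theorem const_mul [Fintype m] (A : Matrix l m ℂ) (hF : HasMatDerivAt F F' s) :
    HasMatDerivAt (fun t => A * F t) (A * F') s := by
  simpa using (const A s).mul hF

theorem mul_const [Fintype n] (hF : HasMatDerivAt F F' s) (A : Matrix n l ℂ) :
    HasMatDerivAt (fun t => F t * A) (F' * A) s := by
  simpa using hF.mul (const A s)

theorem mulVec [Fintype n] {v : ℝ → n → ℂ} {v' : n → ℂ}
    (hF : HasMatDerivAt F F' s) (hv : HasDerivAt v v' s) :
    HasDerivAt (fun t => F t *ᵥ v t) (F' *ᵥ v s + F s *ᵥ v') s := by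
  refine hasDerivAt_pi.2 fun i => ?_
  have h := HasDerivAt.fun_sum (u := Finset.univ) fun k _ =>
    (hF i k).mul (hasDerivAt_pi.1 hv k)
  simpa [Matrix.mulVec, dotProduct, Finset.sum_add_distrib] using h

theorem unique (hF : HasMatDerivAt F F' s) (hG : HasMatDerivAt F G' s) : F' = G' := by
  ext i j
  exact (hF i j).unique (hG i j)

theorem congr_of_eventuallyEq (hF : HasMatDerivAt F F' s) (h : G =ᶠ[𝓝 s] F) :
    HasMatDerivAt G F' s :=
  fun i j => (hF i j).congr_of_eventuallyEq (h.mono fun t ht => by simp [ht])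

variable [Fintype n] [DecidableEq n]

/-- Jacobi's formula. -/
theorem det {F : ℝ → Matrix n n ℂ} {F' : Matrix n n ℂ} (hF : HasMatDerivAt F F' s) :
    HasDerivAt (fun t => (F t).det) ((F s).adjugate * F').trace s := by
  have h : HasDerivAt (fun t => ∑ p : Equiv.Perm n, (Equiv.Perm.sign p : ℂ) * ∏ i, F t (p i) i)
      (∑ p : Equiv.Perm n, (Equiv.Perm.sign p : ℂ) *
        ∑ i, (∏ j ∈ Finset.univ.erase i, F s (p j) j) * F' (p i) i) s := by
    refine HasDerivAt.fun_sum fun p _ => HasDerivAt.const_mul _ ?_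
    simpa using HasDerivAt.fun_finsetProd (u := Finset.univ) fun i _ => hF (p i) i
  have e : ((F s).adjugate * F').trace = ∑ p : Equiv.Perm n, (Equiv.Perm.sign p : ℂ) *
        ∑ i, (∏ j ∈ Finset.univ.erase i, F s (p j) j) * F' (p i) i := by
    -- Cramer's rule: a diagonal entry is the determinant with one column replaced by its
    -- derivative.
    have h1 : ∀ i, ((F s).adjugate * F') i i = ((F s).updateCol i (fun k => F' k i)).det := by
      intro i
      rw [← cramer_apply, cramer_eq_adjugate_mulVec]
      rfl
    simp only [trace, diag, h1, det_apply', Finset.mul_sum]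
    rw [Finset.sum_comm]
    refine Finset.sum_congr rfl fun p _ => Finset.sum_congr rfl fun i _ => ?_
    rw [← Finset.prod_erase_mul _ _ (Finset.mem_univ i), updateCol_self]
    congr 2
    exact Finset.prod_congr rfl fun j hj => updateCol_ne (Finset.ne_of_mem_erase hj)
  rw [e]
  simpa only [det_apply'] using h

/-- Cofactors are determinants, so the inverse is differentiable; its derivative is then forced by
differentiating `F⁻¹ F = 1`, which holds near `s`. -/
theorem inv {F : ℝ → Matrix n n ℂ} {F' : Matrix n n ℂ} (hF : HasMatDerivAt F F' s)
    (h0 : (F s).det ≠ 0) :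
    HasMatDerivAt (fun t => (F t)⁻¹) (-((F s)⁻¹ * F' * (F s)⁻¹)) s := by
  have hadj : ∀ i j, DifferentiableAt ℝ (fun t => (F t).adjugate i j) s := by
    intro i j
    have : HasMatDerivAt (fun t => (F t).updateRow j (Pi.single i 1)) (F'.updateRow j 0) s := by
      intro k l
      by_cases hk : k = j
      · subst hk
        simpa using hasDerivAt_const s _
      · simpa [updateRow_ne hk] using hF k l
    simpa only [adjugate_apply] using this.det.differentiableAt
  have hdiff : ∀ i j, DifferentiableAt ℝ (fun t => (F t)⁻¹ i j) s := by
    intro i j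
    simp only [inv_def, Matrix.smul_apply, Ring.inverse_eq_inv', smul_eq_mul]
    exact (hF.det.differentiableAt.inv h0).mul (hadj i j)
  have hG : HasMatDerivAt (fun t => (F t)⁻¹) (of fun i j => deriv (fun t => (F t)⁻¹ i j) s) s :=
    fun i j => (hdiff i j).hasDerivAt
  have h1 : HasMatDerivAt (fun t => (F t)⁻¹ * F t) 0 s := by
    refine (const 1 s).congr_of_eventuallyEq ?_
    filter_upwards [hF.det.continuousAt.eventually_ne h0] with t ht
    exact nonsing_inv_mul _ (isUnit_iff_ne_zero.2 ht)
  have h2 := congrArg (· * (F s)⁻¹) ((hG.mul hF).unique h1)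
  simp only [Matrix.add_mul, Matrix.mul_assoc,
    mul_nonsing_inv _ (isUnit_iff_ne_zero.2 h0), Matrix.mul_one, Matrix.zero_mul] at h2
  rw [Matrix.mul_assoc, ← eq_neg_of_add_eq_zero_left h2]
  exact hG

theorem logDeriv_det {F : ℝ → Matrix n n ℂ} {F' : Matrix n n ℂ} (hF : HasMatDerivAt F F' s) :
    logDeriv (fun t => (F t).det) s = ((F s)⁻¹ * F').trace := by
  rw [logDeriv_apply, hF.det.deriv, inv_def, Ring.inverse_eq_inv', Matrix.smul_mul, trace_smul,
    smul_eq_mul, div_eq_inv_mul]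

end HasMatDerivAt

end MatrixCalculus

/-! ### Noncommutative identities behind the dressing -/

section DressingAlgebra

variable {ι : Type*} [Fintype ι] [DecidableEq ι] {L Li Λ M M' N N' C : Matrix ι ι ℂ}
  {Y Y' : Matrix (Fin 2) ι ℂ} {Z Z' : Matrix ι (Fin 2) ℂ} {A S Q : Matrix (Fin 2) (Fin 2) ℂ} {κ : ℂ}

/-- In this section `L`, `Z`, `N` stand for `Λ†`, `Y† J`, `M⁻¹`, and primes for the index `n + 1`.
Multiplying the Sylvester equation by `N` on both sides lets `Λ` move across `N` and become `L`. -/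
theorem sylvester_mul_inv (hMN : M * N = 1) (hNM : N * M = 1) (hS : L * M - M * Λ = Z * Y) :
    Y * Λ * N = Y * N * L - Y * N * Z * (Y * N) := by
  have h : N * (L * M - M * Λ) * N = N * (Z * Y) * N := by rw [hS]
  have e1 : N * (L * M) * N = N * L := by simp only [Matrix.mul_assoc, hMN, Matrix.mul_one]
  have e2 : N * (M * Λ) * N = Λ * N := by rw [← Matrix.mul_assoc, hNM, Matrix.one_mul]
  rw [Matrix.mul_sub, Matrix.sub_mul, e1, e2] at h
  rw [Matrix.mul_assoc, ← sub_sub_cancel (N * L) (Λ * N), h]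
  simp only [Matrix.mul_sub, Matrix.mul_assoc]

/-- Cancelling one factor `L` from the shift rule of `M` gives `M' Λ + Z' Y = (L + κ L⁻¹) M`.
Multiplying by `Y' N'` and `N` removes both copies of `M`, and the shift of `Y` does the rest. -/
theorem dressing_shift_key (hLi : Li * L = 1) (hMN : M * N = 1) (hNM : N * M = 1)
    (hNM' : N' * M' = 1) (hS : L * M - M * Λ = Z * Y) (hY : Y' * Λ = Y * Λ + A * Y)
    (hZ : L * Z' = L * Z - Z * A)
    (hM : L * M' * Λ = L * M * Λ + Z * A * Y + κ • M) :
    Y' * N' * (L + κ • Li) = Y * N * L + (A + Y' * N' * Z' - Y * N * Z) * (Y * N) := by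
  have h1 : L * M + κ • (Li * M) = M' * Λ + Z' * Y := by
    have h : L * (M' * Λ + Z' * Y) = L * (L * M) + κ • M := by
      have hS' : L * (L * M) = L * (M * Λ + Z * Y) := by rw [← hS]; simp
      rw [hS', Matrix.mul_add, ← Matrix.mul_assoc, ← Matrix.mul_assoc, hM, hZ]
      simp only [Matrix.mul_add, Matrix.sub_mul, Matrix.mul_assoc]
      abel
    have h2 := congrArg (Li * ·) h
    simp only [Matrix.mul_add, ← Matrix.mul_assoc, hLi, Matrix.one_mul, Matrix.mul_smul] at h2
    exact h2.symm
  have h2 : L + κ • Li = M' * Λ * N + Z' * Y * N := by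
    have h := congrArg (· * N) h1
    simpa only [Matrix.add_mul, Matrix.smul_mul, Matrix.mul_assoc, hMN, Matrix.mul_one] using h
  have h3 : Y' * N' * (M' * Λ * N) = Y' * Λ * N := by
    simp only [Matrix.mul_assoc]
    rw [← Matrix.mul_assoc N' M', hNM', Matrix.one_mul]
  rw [h2, Matrix.mul_add, h3, hY, Matrix.add_mul, sylvester_mul_inv hMN hNM hS]
  simp only [Matrix.add_mul, Matrix.sub_mul, Matrix.mul_assoc]
  abel

/-- Since `A² = -κ`, the same factor appears on the dual side: `L Z' + Z' A = (L + κ L⁻¹) Z`. It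
commutes with `C`, so it can be carried over to `Y' N'`, where `dressing_shift_key` applies. -/
theorem dressing_shift (hLi : Li * L = 1) (hMN : M * N = 1) (hNM : N * M = 1)
    (hNM' : N' * M' = 1) (hS : L * M - M * Λ = Z * Y) (hY : Y' * Λ = Y * Λ + A * Y)
    (hZ : L * Z' = L * Z - Z * A) (hA : A * A = -(κ • 1))
    (hM : L * M' * Λ = L * M * Λ + Z * A * Y + κ • M) (hC : C * L = L * C) :
    Y' * N' * (L * C) * Z' + Y' * N' * C * Z' * A =
      Y * N * (L * C) * Z + (A + Y' * N' * Z' - Y * N * Z) * (Y * N * C * Z) := by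
  have hCi : C * Li = Li * C := by
    have h := congrArg (fun X => Li * X * Li) hC
    have hLi' : L * Li = 1 := mul_eq_one_comm.1 hLi
    simp only [Matrix.mul_assoc, hLi', Matrix.mul_one] at h
    simp only [← Matrix.mul_assoc, hLi, Matrix.one_mul] at h
    exact h.symm
  have h1 : L * Z' + Z' * A = (L + κ • Li) * Z := by
    have h : L * (L * Z' + Z' * A) = L * (L * Z) + κ • Z := by
      rw [Matrix.mul_add, ← Matrix.mul_assoc L Z' A, hZ]
      simp only [Matrix.mul_sub, Matrix.sub_mul, Matrix.mul_assoc, hA, Matrix.mul_neg,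
        Matrix.mul_smul, Matrix.mul_one]
      abel
    have h2 := congrArg (Li * ·) h
    simp only [← Matrix.mul_assoc, hLi, Matrix.one_mul, Matrix.mul_smul, Matrix.mul_add] at h2
    simpa only [Matrix.add_mul, Matrix.smul_mul] using h2
  have h2 := congrArg (Y' * N' * C * ·) h1
  have h3 := congrArg (· * (C * Z)) (dressing_shift_key hLi hMN hNM hNM' hS hY hZ hM)
  calc Y' * N' * (L * C) * Z' + Y' * N' * C * Z' * A
      = Y' * N' * C * (L * Z' + Z' * A) := by
        rw [← hC]; simp only [Matrix.mul_add, Matrix.mul_assoc]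
    _ = Y' * N' * (L + κ • Li) * (C * Z) := by
        rw [h1]
        have : C * (L + κ • Li) = (L + κ • Li) * C := by
          rw [Matrix.mul_add, Matrix.add_mul, hC, Matrix.mul_smul, Matrix.smul_mul, hCi]
        rw [← Matrix.mul_assoc, Matrix.mul_assoc (Y' * N') C, this]
        simp only [Matrix.mul_assoc]
    _ = _ := by
        rw [h3, Matrix.add_mul]
        simp only [Matrix.mul_assoc]

/-- The left side is the product rule for `Y N C Z` with the derivatives of `Y`, `N`, `Z` inserted.
Only `Λ` between `Y` and `N` is foreign to moments, and `sylvester_mul_inv` replaces it by `L`. -/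
theorem dressing_deriv (hMN : M * N = 1) (hNM : N * M = 1)
    (hS : L * M - M * Λ = Z * Y) (c d : ℂ) :
    ((c • (S * Y * Λ) + d • (Q * Y)) * N + Y * (-(N * (-(c • (Z * S * Y))) * N))) * C * Z
        + Y * N * C * (-(c • (L * Z * S)) - d • (Z * Q)) =
      c • (S * (Y * N * (L * C) * Z) + (Y * N * Z * S - S * (Y * N * Z)) * (Y * N * C * Z)
        - Y * N * (C * L) * Z * S) + d • (Q * (Y * N * C * Z) - Y * N * C * Z * Q) := by
  have h : S * Y * Λ * N = S * (Y * N * L - Y * N * Z * (Y * N)) := by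
    rw [← sylvester_mul_inv hMN hNM hS]; simp only [Matrix.mul_assoc]
  simp only [Matrix.add_mul, Matrix.smul_mul, h]
  simp only [Matrix.mul_sub, Matrix.sub_mul, Matrix.mul_assoc, Matrix.smul_mul,
    Matrix.mul_smul, Matrix.neg_mul, Matrix.mul_neg, neg_neg]
  module

end DressingAlgebra

/-! ### Coefficients of the Lax matrices and their symmetries -/

section LaxCoefficients

/-- The Pauli matrix `σ₃`. -/
def sigma3 : Matrix (Fin 2) (Fin 2) ℂ := !![1, 0; 0, -1]

/-- The potential matrix `Q` of the temporal Lax matrix. -/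
def potQ (σ : ℝ) (w : ℂ) : Matrix (Fin 2) (Fin 2) ℂ := !![0, (σ : ℂ) * star w; w, 0]

/-- The residue at `z = 0` of the spatial Lax matrix. -/
def laxA (a σ : ℝ) (ρ : ℤ → ℝ → ℝ) (q : ℤ → ℝ → ℂ) (n : ℤ) (s : ℝ) :
    Matrix (Fin 2) (Fin 2) ℂ :=
  !![-(Complex.I * a * ρ n s), -(σ : ℂ) * (star (q (n + 1) s) - star (q n s));
     q (n + 1) s - q n s, Complex.I * a * ρ n s]

variable (a σ : ℝ) (ρ : ℤ → ℝ → ℝ) (q : ℤ → ℝ → ℂ) (z : ℂ) (n : ℤ) (s : ℝ)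

theorem laxU_eq : laxU a σ ρ q z n s = 1 + z⁻¹ • laxA a σ ρ q n s := by
  ext i j
  fin_cases i <;> fin_cases j <;> simp [laxU, laxA] <;> ring

theorem laxV_eq :
    laxV σ q z n s = (Complex.I / 4 * z) • sigma3 + (Complex.I / 2) • potQ σ (q n s) := rfl

/-- Cayley–Hamilton for a traceless matrix; the scalar is its determinant. -/
theorem laxA_sq : laxA a σ ρ q n s * laxA a σ ρ q n s =
    -((((a * ρ n s) ^ 2 : ℝ) + σ * ((q (n + 1) s - q n s) *
      (star (q (n + 1) s) - star (q n s)))) • 1) := by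
  ext i j
  fin_cases i <;> fin_cases j <;> simp [laxA, Matrix.mul_apply, Fin.sum_univ_two] <;> ring_nf <;>
    simp <;> ring

/-- The residue is anti-self-adjoint for `J`, while `Q` and `σ₃` below are self-adjoint. This makes
`Y† J` a solution of the dual Lax pair. -/
theorem laxA_conjTranspose_mul_J :
    (laxA a σ ρ q n s)ᴴ * J σ = -(J σ * laxA a σ ρ q n s) := by
  ext i j
  fin_cases i <;> fin_cases j <;>
    simp [laxA, J, Matrix.mul_apply, Fin.sum_univ_two] <;>
    ring1

theorem potQ_conjTranspose_mul_J (w : ℂ) : (potQ σ w)ᴴ * J σ = J σ * potQ σ w := by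
  ext i j
  fin_cases i <;> fin_cases j <;>
    simp [potQ, J, Matrix.mul_apply, Fin.sum_univ_two, mul_comm]

theorem sigma3_conjTranspose_mul_J : sigma3ᴴ * J σ = J σ * sigma3 := by
  ext i j
  fin_cases i <;> fin_cases j <;>
    simp [sigma3, J, Matrix.mul_apply, Fin.sum_univ_two]

theorem J_conjTranspose : (J σ)ᴴ = J σ := by
  ext i j
  fin_cases i <;> fin_cases j <;> simp [J]

end LaxCoefficients

/-! ### Dressing data and their moments -/

section Dressing

variable {ι : Type*} [Fintype ι] [DecidableEq ι]

/-- The data `(Λ, Y, M)` of a dressing transformation: `Y` solves the Lax pair with the matrix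
`Λ` as spectral parameter, and `M` solves the Sylvester equation `Λ† M - M Λ = Y† J Y`, whose
solution is unique. -/
structure IsDressing (a σ : ℝ) (ρ : ℤ → ℝ → ℝ) (q : ℤ → ℝ → ℂ) (Λ : Matrix ι ι ℂ)
    (Y : ℤ → ℝ → Matrix (Fin 2) ι ℂ) (M : ℤ → ℝ → Matrix ι ι ℂ) : Prop where
  sylvester_inj : ∀ X : Matrix ι ι ℂ, Λᴴ * X = X * Λ → X = 0
  sylvester : ∀ n s, Λᴴ * M n s - M n s * Λ = (Y n s)ᴴ * J σ * Y n s
  shift : ∀ n s, Y (n + 1) s * Λ = Y n s * Λ + laxA a σ ρ q n s * Y n s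
  hasMatDerivAt : ∀ n s, HasMatDerivAt (Y n) ((Complex.I / 4) • (sigma3 * Y n s * Λ) +
    (Complex.I / 2) • (potQ σ (q n s) * Y n s)) s
  exists_hasMatDerivAt : ∀ n s, ∃ M', HasMatDerivAt (M n) M' s

/-- The moment `Y M⁻¹ C Y† J` of a dressing. -/
def moment (σ : ℝ) (Y : Matrix (Fin 2) ι ℂ) (M C : Matrix ι ι ℂ) : Matrix (Fin 2) (Fin 2) ℂ :=
  Y * M⁻¹ * C * (Yᴴ * J σ)

/-- The coefficient `Y M⁻¹ Y† J` of `1 / z` in the Darboux matrix at infinity. -/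
def residue (σ : ℝ) (Y : Matrix (Fin 2) ι ℂ) (M : Matrix ι ι ℂ) : Matrix (Fin 2) (Fin 2) ℂ :=
  Y * M⁻¹ * (Yᴴ * J σ)

theorem moment_one (σ : ℝ) (Y : Matrix (Fin 2) ι ℂ) (M : Matrix ι ι ℂ) :
    moment σ Y M 1 = residue σ Y M := by
  rw [moment, residue, Matrix.mul_one]

/-- Schur complement of the block `M`: what remains is `Y₂ M⁻¹ Y₁†`, and the relevant entry of `J`
is `1`. -/
theorem det_matG (σ : ℝ) (Y : Matrix (Fin 2) ι ℂ) {M : Matrix ι ι ℂ} (hM : M.det ≠ 0) :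
    (matG Y M).det / M.det = residue σ Y M 1 0 := by
  let _ : Invertible M := M.invertibleOfIsUnitDet (isUnit_iff_ne_zero.2 hM)
  rw [matG, det_fromBlocks₁₁, mul_div_cancel_left₀ _ hM, det_unique, invOf_eq_nonsing_inv]
  simp [residue, Matrix.mul_apply, J, Fin.sum_univ_two, Finset.sum_mul]

namespace IsDressing

variable {a σ : ℝ} {ρ : ℤ → ℝ → ℝ} {q : ℤ → ℝ → ℂ} {Λ : Matrix ι ι ℂ}
  {Y : ℤ → ℝ → Matrix (Fin 2) ι ℂ} {M : ℤ → ℝ → Matrix ι ι ℂ}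

/-- If `Λ†` were singular, so would be `Λ`. A right null vector of `Λ†` times a left null vector of
`Λ` would then be a nonzero rank-one solution of the homogeneous Sylvester equation. -/
theorem inv_mul_conjTranspose (h : IsDressing a σ ρ q Λ Y M) : (Λᴴ)⁻¹ * Λᴴ = 1 := by
  refine nonsing_inv_mul _ (isUnit_iff_ne_zero.2 fun h0 => ?_)
  have h1 : Λ.det = 0 := by simpa [det_conjTranspose] using h0
  obtain ⟨v, hv, hvΛ⟩ := exists_mulVec_eq_zero_iff.2 h0
  obtain ⟨w, hw, hwΛ⟩ := exists_vecMul_eq_zero_iff.2 h1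
  have h2 := h.sylvester_inj (vecMulVec v w) (by
    rw [mul_vecMulVec, hvΛ, vecMulVec_mul, hwΛ]; simp)
  obtain ⟨i, hi⟩ := Function.ne_iff.1 hv
  obtain ⟨j, hj⟩ := Function.ne_iff.1 hw
  have h3 := congrFun (congrFun h2 i) j
  simp only [vecMulVec_apply, Matrix.zero_apply, mul_eq_zero] at h3
  exact h3.elim hi hj

/-- The right side of the Sylvester equation is Hermitian, so `M† + M` solves the homogeneous
equation. -/
theorem conjTranspose_eq_neg (h : IsDressing a σ ρ q Λ Y M) (n : ℤ) (s : ℝ) :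
    (M n s)ᴴ = -M n s := by
  have h1 := h.sylvester n s
  have h2 := congrArg conjTranspose h1
  simp only [conjTranspose_sub, conjTranspose_mul, conjTranspose_conjTranspose, J_conjTranspose,
    ← Matrix.mul_assoc] at h2
  have h3 := h.sylvester_inj ((M n s)ᴴ + M n s) (by
    rw [Matrix.mul_add, Matrix.add_mul, ← sub_eq_zero]
    rw [← h1] at h2
    rw [← sub_eq_zero] at h2
    rw [← neg_eq_zero, ← h2]
    abel)
  exact eq_neg_of_add_eq_zero_left h3

theorem residue_form (h : IsDressing a σ ρ q Λ Y M) (n : ℤ) (s : ℝ) :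
    star (residue σ (Y n s) (M n s) 0 0) = -residue σ (Y n s) (M n s) 0 0 ∧
    residue σ (Y n s) (M n s) 0 1 = -(σ * star (residue σ (Y n s) (M n s) 1 0)) := by
  have h1 : (Y n s * (M n s)⁻¹ * (Y n s)ᴴ)ᴴ = -(Y n s * (M n s)⁻¹ * (Y n s)ᴴ) := by
    -- This also holds where `M` is singular, the inverse being `0` there; so the symmetry of the
    -- residue needs no condition on `det M`.
    have hinv : ((M n s)⁻¹)ᴴ = -(M n s)⁻¹ := by
      rw [conjTranspose_nonsing_inv, h.conjTranspose_eq_neg]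
      by_cases hu : IsUnit (M n s).det
      · refine inv_eq_left_inv ?_
        rw [neg_mul_neg, nonsing_inv_mul _ hu]
      · rw [nonsing_inv_apply_not_isUnit _ hu, nonsing_inv_apply_not_isUnit, neg_zero]
        rwa [det_neg, IsUnit.mul_iff, not_and_or, or_iff_right]
        exact not_not_intro ((isUnit_one.neg).pow _)
    simp only [conjTranspose_mul, conjTranspose_conjTranspose, hinv]
    simp only [Matrix.mul_assoc, Matrix.neg_mul, Matrix.mul_neg]
  have e : residue σ (Y n s) (M n s) = Y n s * (M n s)⁻¹ * (Y n s)ᴴ * J σ := by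
    rw [residue, Matrix.mul_assoc, Matrix.mul_assoc, Matrix.mul_assoc]
  generalize Y n s * (M n s)⁻¹ * (Y n s)ᴴ = K at h1 e
  have h00 := congrFun (congrFun h1 0) 0
  have h01 := congrFun (congrFun h1 0) 1
  simp only [conjTranspose_apply, Matrix.neg_apply] at h00 h01
  rw [e]
  constructor
  · simpa [Matrix.mul_apply, J, Fin.sum_univ_two] using h00
  · simp only [Matrix.mul_apply, J, Fin.sum_univ_two]
    simp [-RCLike.star_def, h01, mul_comm]

/-- By cyclicity the trace is that of `M⁻¹ Y† J Y = M⁻¹ (Λ† M - M Λ)`, which depends on `Λ` alone.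
-/
theorem trace_residue (h : IsDressing a σ ρ q Λ Y M) {n : ℤ} {s : ℝ} (h0 : (M n s).det ≠ 0) :
    residue σ (Y n s) (M n s) 1 1 = Λᴴ.trace - Λ.trace - residue σ (Y n s) (M n s) 0 0 := by
  have hu := isUnit_iff_ne_zero.2 h0
  have h1 : (residue σ (Y n s) (M n s)).trace = Λᴴ.trace - Λ.trace := by
    rw [residue, Matrix.mul_assoc, trace_mul_comm, Matrix.mul_assoc, ← h.sylvester,
      Matrix.mul_sub, trace_sub, ← Matrix.mul_assoc, ← Matrix.mul_assoc, nonsing_inv_mul _ hu,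
      Matrix.one_mul, trace_mul_comm, ← Matrix.mul_assoc, mul_nonsing_inv _ hu, Matrix.one_mul]
  rw [← h1, trace_fin_two]
  ring

theorem conjTranspose_shift (h : IsDressing a σ ρ q Λ Y M) (n : ℤ) (s : ℝ) :
    Λᴴ * ((Y (n + 1) s)ᴴ * J σ) =
      Λᴴ * ((Y n s)ᴴ * J σ) - (Y n s)ᴴ * J σ * laxA a σ ρ q n s := by
  have h1 := congrArg (fun X => Xᴴ * J σ) (h.shift n s)
  simp only [conjTranspose_mul, conjTranspose_add, Matrix.add_mul, Matrix.mul_assoc,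
    laxA_conjTranspose_mul_J, Matrix.mul_neg] at h1
  rw [h1, Matrix.mul_assoc, sub_eq_add_neg]

theorem conjTranspose_hasMatDerivAt (h : IsDressing a σ ρ q Λ Y M) (n : ℤ) (s : ℝ) :
    HasMatDerivAt (fun t => (Y n t)ᴴ * J σ)
      (-((Complex.I / 4) • (Λᴴ * ((Y n s)ᴴ * J σ) * sigma3)) -
        (Complex.I / 2) • ((Y n s)ᴴ * J σ * potQ σ (q n s))) s := by
  convert (h.hasMatDerivAt n s).conjTranspose.mul_const (J σ) using 1
  simp only [conjTranspose_add, conjTranspose_smul, conjTranspose_mul, Matrix.add_mul,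
    Matrix.smul_mul, Matrix.mul_assoc, potQ_conjTranspose_mul_J, sigma3_conjTranspose_mul_J]
  simp
  module

/-- The difference of the two sides is annihilated by the Sylvester operator, as the shift rules of
`Y` and `Y† J` and `A² = -κ` show. -/
theorem sylvester_shift (h : IsDressing a σ ρ q Λ Y M) (n : ℤ) (s : ℝ)
    {κ : ℂ} (hκ : laxA a σ ρ q n s * laxA a σ ρ q n s = -(κ • 1)) :
    Λᴴ * M (n + 1) s * Λ = Λᴴ * M n s * Λ +
      (Y n s)ᴴ * J σ * laxA a σ ρ q n s * Y n s + κ • M n s := by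
  have hY := h.shift n s
  have hZ := h.conjTranspose_shift n s
  have h0 := h.sylvester n s
  have h1 := h.sylvester (n + 1) s
  generalize (Y n s)ᴴ * J σ = Z at *
  generalize (Y (n + 1) s)ᴴ * J σ = Z' at *
  generalize laxA a σ ρ q n s = A at *
  have h2 : Λᴴ * (Λᴴ * M (n + 1) s - M (n + 1) s * Λ) * Λ =
      Λᴴ * (Λᴴ * M n s - M n s * Λ) * Λ + (Λᴴ * (Z * A * Y n s) - Z * A * Y n s * Λ) +
        κ • (Λᴴ * M n s - M n s * Λ) := by
    rw [h1, h0, ← Matrix.mul_assoc, Matrix.mul_assoc, hZ, hY]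
    have h3 : Z * A * A = -(κ • Z) := by
      rw [Matrix.mul_assoc, hκ, Matrix.mul_neg, Matrix.mul_smul, Matrix.mul_one]
    have h4 : Z * (A * (A * Y n s)) = -(κ • (Z * Y n s)) := by
      rw [← Matrix.mul_assoc, ← Matrix.mul_assoc, h3, Matrix.neg_mul, Matrix.smul_mul]
    simp only [Matrix.mul_add, Matrix.sub_mul, Matrix.mul_assoc, h4]
    abel
  rw [← sub_eq_zero]
  refine h.sylvester_inj _ ?_
  rw [← sub_eq_zero] at h2 ⊢
  rw [← h2]
  simp only [Matrix.mul_add, Matrix.add_mul, Matrix.mul_sub, Matrix.sub_mul, Matrix.mul_assoc,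
    Matrix.smul_mul, Matrix.mul_smul]
  module

/-- Differentiate the Sylvester equation. The `Q` terms cancel, and the `σ₃` terms are the Sylvester
operator applied to `-(i/4) Y† J σ₃ Y`; injectivity identifies `M'`. -/
theorem hasMatDerivAt_M (h : IsDressing a σ ρ q Λ Y M) (n : ℤ) (s : ℝ) :
    HasMatDerivAt (M n) (-((Complex.I / 4) • ((Y n s)ᴴ * J σ * sigma3 * Y n s))) s := by
  obtain ⟨M', hM'⟩ := h.exists_hasMatDerivAt n s
  have h1 := (hM'.const_mul Λᴴ).sub (hM'.mul_const Λ)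
  have h2 := (h.conjTranspose_hasMatDerivAt n s).mul (h.hasMatDerivAt n s)
  simp only [h.sylvester] at h1
  have h3 := h1.unique h2
  have h4 : M' = -((Complex.I / 4) • ((Y n s)ᴴ * J σ * sigma3 * Y n s)) := by
    rw [← sub_eq_zero]
    refine h.sylvester_inj _ ?_
    rw [← sub_eq_zero] at h3 ⊢
    rw [← h3]
    simp only [Matrix.mul_add, Matrix.mul_sub, Matrix.sub_mul, Matrix.mul_assoc,
      Matrix.smul_mul, Matrix.mul_smul, Matrix.neg_mul, Matrix.mul_neg]
    module
  rwa [← h4]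

theorem moment_shift (h : IsDressing a σ ρ q Λ Y M) {n : ℤ} {s : ℝ}
    (h0 : (M n s).det ≠ 0) (h1 : (M (n + 1) s).det ≠ 0) {C : Matrix ι ι ℂ}
    (hC : C * Λᴴ = Λᴴ * C) :
    moment σ (Y (n + 1) s) (M (n + 1) s) (Λᴴ * C) +
        moment σ (Y (n + 1) s) (M (n + 1) s) C * laxA a σ ρ q n s =
      moment σ (Y n s) (M n s) (Λᴴ * C) +
        (laxA a σ ρ q n s + residue σ (Y (n + 1) s) (M (n + 1) s) - residue σ (Y n s) (M n s)) *
          moment σ (Y n s) (M n s) C := by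
  have hu := isUnit_iff_ne_zero.2 h0
  exact dressing_shift h.inv_mul_conjTranspose (mul_nonsing_inv _ hu) (nonsing_inv_mul _ hu)
    (nonsing_inv_mul _ (isUnit_iff_ne_zero.2 h1)) (h.sylvester n s) (h.shift n s)
    (h.conjTranspose_shift n s) (laxA_sq a σ ρ q n s)
    (h.sylvester_shift n s (laxA_sq a σ ρ q n s)) hC

theorem moment_hasMatDerivAt (h : IsDressing a σ ρ q Λ Y M) {n : ℤ} {s : ℝ}
    (h0 : (M n s).det ≠ 0) (C : Matrix ι ι ℂ) :
    HasMatDerivAt (fun t => moment σ (Y n t) (M n t) C)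
      ((Complex.I / 4) • (sigma3 * moment σ (Y n s) (M n s) (Λᴴ * C) +
        (residue σ (Y n s) (M n s) * sigma3 - sigma3 * residue σ (Y n s) (M n s)) *
          moment σ (Y n s) (M n s) C - moment σ (Y n s) (M n s) (C * Λᴴ) * sigma3) +
        (Complex.I / 2) • (potQ σ (q n s) * moment σ (Y n s) (M n s) C -
          moment σ (Y n s) (M n s) C * potQ σ (q n s))) s := by
  have hu := isUnit_iff_ne_zero.2 h0
  have h1 := (((h.hasMatDerivAt n s).mul ((h.hasMatDerivAt_M n s).inv h0)).mul_const C).mul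
    (h.conjTranspose_hasMatDerivAt n s)
  have h2 := dressing_deriv (S := sigma3) (Q := potQ σ (q n s)) (C := C) (mul_nonsing_inv _ hu)
    (nonsing_inv_mul _ hu) (h.sylvester n s) (Complex.I / 4) (Complex.I / 2)
  unfold moment residue
  rw [← h2]
  exact h1

end IsDressing

end Dressing

/-! ### Intertwining relations and the dressed potentials -/

section Darboux

variable {ι : Type*} [Fintype ι] [DecidableEq ι]

/-- The dressed potential `q`. -/
def dressedQ (σ : ℝ) (q : ℤ → ℝ → ℂ) (Y : ℤ → ℝ → Matrix (Fin 2) ι ℂ)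
    (M : ℤ → ℝ → Matrix ι ι ℂ) (n : ℤ) (s : ℝ) : ℂ :=
  q n s + residue σ (Y n s) (M n s) 1 0

/-- The dressed potential `ρ`. -/
def dressedRho (a σ : ℝ) (ρ : ℤ → ℝ → ℝ) (Y : ℤ → ℝ → Matrix (Fin 2) ι ℂ)
    (M : ℤ → ℝ → Matrix ι ι ℂ) (n : ℤ) (s : ℝ) : ℝ :=
  ρ n s + (Complex.I / a * (residue σ (Y (n + 1) s) (M (n + 1) s) 0 0 -
    residue σ (Y n s) (M n s) 0 0)).re

namespace IsDressing

variable {a σ : ℝ} {ρ : ℤ → ℝ → ℝ} {q : ℤ → ℝ → ℂ} {Λ : Matrix ι ι ℂ}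
  {Y : ℤ → ℝ → Matrix (Fin 2) ι ℂ} {M : ℤ → ℝ → Matrix ι ι ℂ}

theorem ofReal_dressedRho (h : IsDressing a σ ρ q Λ Y M) (n : ℤ) (s : ℝ) :
    (dressedRho a σ ρ Y M n s : ℂ) = ρ n s + Complex.I / a *
      (residue σ (Y (n + 1) s) (M (n + 1) s) 0 0 - residue σ (Y n s) (M n s) 0 0) := by
  rw [dressedRho, Complex.ofReal_add, add_right_inj, ← Complex.conj_eq_iff_re]
  have h0 := (h.residue_form n s).1
  have h1 := (h.residue_form (n + 1) s).1
  simp only [RCLike.star_def] at h0 h1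
  simp only [map_mul, map_div₀, map_sub, Complex.conj_I, Complex.conj_ofReal, h0, h1]
  ring

/-- The off-diagonal entries fit by the symmetry of the residue. The lower right one fits because
the trace of the residue does not depend on `n`, so the diagonal increments are opposite. -/
theorem laxA_dressed (h : IsDressing a σ ρ q Λ Y M) (ha : a ≠ 0) {n : ℤ} {s : ℝ}
    (h0 : (M n s).det ≠ 0) (h1 : (M (n + 1) s).det ≠ 0) :
    laxA a σ (dressedRho a σ ρ Y M) (dressedQ σ q Y M) n s =
      laxA a σ ρ q n s + residue σ (Y (n + 1) s) (M (n + 1) s) - residue σ (Y n s) (M n s) := by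
  have ha' : (a : ℂ) ≠ 0 := by exact_mod_cast ha
  have e0 := (h.residue_form n s).2
  have e1 := (h.residue_form (n + 1) s).2
  have t0 := h.trace_residue h0
  have t1 := h.trace_residue h1
  have hI : Complex.I * a * (Complex.I / a) = -1 := by
    field_simp
    simp
  ext i j
  fin_cases i <;> fin_cases j <;>
    simp only [laxA, dressedQ, h.ofReal_dressedRho, Matrix.add_apply, Matrix.sub_apply, star_add,
      Fin.zero_eta, Fin.mk_one, of_apply, cons_val', cons_val_zero, cons_val_one, cons_val_fin_one,
      e0, e1, t0, t1]
  · linear_combination -(residue σ (Y (n + 1) s) (M (n + 1) s) 0 0 -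
      residue σ (Y n s) (M n s) 0 0) * hI
  · ring
  · ring
  · linear_combination (residue σ (Y (n + 1) s) (M (n + 1) s) 0 0 -
      residue σ (Y n s) (M n s) 0 0) * hI

theorem potQ_dressed (h : IsDressing a σ ρ q Λ Y M) (n : ℤ) (s : ℝ) :
    potQ σ (dressedQ σ q Y M n s) = potQ σ (q n s) + (1 / 2 : ℂ) •
      (residue σ (Y n s) (M n s) * sigma3 - sigma3 * residue σ (Y n s) (M n s)) := by
  have e0 := (h.residue_form n s).2
  ext i j
  fin_cases i <;> fin_cases j <;>
    simp [-RCLike.star_def, potQ, dressedQ, sigma3, Matrix.mul_apply, Fin.sum_univ_two, vecMul, dotProduct, e0] <;> ring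

/-- For the resolvent, `Λ† R = z R - 1`, so the moment of `Λ† R` is `z` times that of `R` minus the
residue. The moment identity divided by `z` is then the intertwining relation. -/
theorem darboux_shift (h : IsDressing a σ ρ q Λ Y M) (ha : a ≠ 0) {n : ℤ} {s : ℝ}
    (h0 : (M n s).det ≠ 0) (h1 : (M (n + 1) s).det ≠ 0) {R : Matrix ι ι ℂ} {z : ℂ} (hz : z ≠ 0)
    (hR : R * (z • 1 - Λᴴ) = 1) :
    (1 + moment σ (Y (n + 1) s) (M (n + 1) s) R) * laxU a σ ρ q z n s =
      laxU a σ (dressedRho a σ ρ Y M) (dressedQ σ q Y M) z n s *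
        (1 + moment σ (Y n s) (M n s) R) := by
  have hR' : (z • 1 - Λᴴ) * R = 1 := mul_eq_one_comm.1 hR
  have hL : Λᴴ * R = z • R - 1 := by rw [← hR']; simp [Matrix.sub_mul]
  have hL' : R * Λᴴ = z • R - 1 := by rw [← hR]; simp [Matrix.mul_sub]
  have hm := h.moment_shift h0 h1 (hL'.trans hL.symm)
  have hmom : ∀ n s, moment σ (Y n s) (M n s) (Λᴴ * R) =
      z • moment σ (Y n s) (M n s) R - residue σ (Y n s) (M n s) := by
    intro n s
    rw [hL, ← moment_one]
    simp only [moment, Matrix.mul_sub, Matrix.sub_mul, Matrix.mul_smul, Matrix.smul_mul]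
  rw [laxU_eq, laxU_eq, h.laxA_dressed ha h0 h1]
  rw [hmom, hmom] at hm
  have hm' := congrArg (z⁻¹ • ·) hm
  simp only [smul_add, smul_sub, smul_smul, inv_mul_cancel₀ hz, one_smul] at hm'
  simp only [Matrix.mul_add, Matrix.add_mul, Matrix.sub_mul, Matrix.smul_mul, smul_add, smul_sub,
    Matrix.mul_smul, Matrix.mul_one, Matrix.one_mul] at hm' ⊢
  linear_combination (norm := module) hm'

theorem darboux_hasMatDerivAt (h : IsDressing a σ ρ q Λ Y M) {n : ℤ} {s : ℝ}
    (h0 : (M n s).det ≠ 0) {R : Matrix ι ι ℂ} {z : ℂ} (hR : R * (z • 1 - Λᴴ) = 1) :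
    HasMatDerivAt (fun t => 1 + moment σ (Y n t) (M n t) R)
      (laxV σ (dressedQ σ q Y M) z n s * (1 + moment σ (Y n s) (M n s) R) -
        (1 + moment σ (Y n s) (M n s) R) * laxV σ q z n s) s := by
  have hR' : (z • 1 - Λᴴ) * R = 1 := mul_eq_one_comm.1 hR
  have hL : Λᴴ * R = z • R - 1 := by rw [← hR']; simp [Matrix.sub_mul]
  have hL' : R * Λᴴ = z • R - 1 := by rw [← hR]; simp [Matrix.mul_sub]
  have hmom : moment σ (Y n s) (M n s) (z • R - 1) =
      z • moment σ (Y n s) (M n s) R - residue σ (Y n s) (M n s) := by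
    rw [← moment_one]
    simp only [moment, Matrix.mul_sub, Matrix.sub_mul, Matrix.mul_smul, Matrix.smul_mul]
  have hm := h.moment_hasMatDerivAt h0 R
  rw [hL, hL', hmom] at hm
  convert (HasMatDerivAt.const 1 s).add hm using 1
  rw [laxV_eq, laxV_eq, h.potQ_dressed]
  simp only [Matrix.mul_add, Matrix.add_mul, Matrix.mul_sub, Matrix.sub_mul, Matrix.smul_mul,
    Matrix.mul_smul, Matrix.mul_one, Matrix.one_mul]
  module

/-- Jacobi's formula gives `-(i/4) tr(R σ₃)` with `R` the residue, and the trace identity eliminates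
its lower right entry. -/
theorem logDeriv_det_eq (h : IsDressing a σ ρ q Λ Y M) {n : ℤ} {s : ℝ}
    (h0 : (M n s).det ≠ 0) :
    logDeriv (fun t => (M n t).det) s = -(Complex.I / 4) *
      (2 * residue σ (Y n s) (M n s) 0 0 - (Λᴴ.trace - Λ.trace)) := by
  have e : ((M n s)⁻¹ * ((Y n s)ᴴ * J σ * sigma3 * Y n s)).trace =
      (residue σ (Y n s) (M n s) * sigma3).trace := by
    rw [← Matrix.mul_assoc, trace_mul_comm, residue]
    simp only [Matrix.mul_assoc]
  rw [(h.hasMatDerivAt_M n s).logDeriv_det, Matrix.mul_neg, Matrix.mul_smul, trace_neg, trace_smul,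
    e, trace_fin_two]
  simp only [sigma3, Matrix.mul_apply, Fin.sum_univ_two, of_apply, cons_val', cons_val_zero,
    cons_val_one, cons_val_fin_one, smul_eq_mul, h.trace_residue h0]
  ring

/-- The case `C = 1`. In the diagonal entry the moment of `Λ†` drops out of the commutator with
`σ₃`, leaving products of off-diagonal entries. In the lower left entry it survives as a new
unknown, to be removed in `solvesAgain`. -/
theorem residue_hasDerivAt (h : IsDressing a σ ρ q Λ Y M) {n : ℤ} {s : ℝ}
    (h0 : (M n s).det ≠ 0) :
    HasDerivAt (fun t => residue σ (Y n t) (M n t) 0 0)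
      (Complex.I * σ / 2 * ((‖dressedQ σ q Y M n s‖ ^ 2 : ℝ) - (‖q n s‖ ^ 2 : ℝ))) s ∧
    HasDerivAt (fun t => residue σ (Y n t) (M n t) 1 0)
      (Complex.I / 2 * (residue σ (Y n s) (M n s) 1 0 * residue σ (Y n s) (M n s) 0 0 +
        q n s * (2 * residue σ (Y n s) (M n s) 0 0 - (Λᴴ.trace - Λ.trace)) -
        moment σ (Y n s) (M n s) Λᴴ 1 0)) s := by
  have hm := h.moment_hasMatDerivAt h0 1
  simp only [Matrix.mul_one, Matrix.one_mul, moment_one] at hm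
  have e0 := (h.residue_form n s).2
  have t0 := h.trace_residue h0
  constructor
  · convert hm 0 0 using 1
    simp only [Complex.ofReal_pow, ← Complex.conj_mul', dressedQ]
    simp [sigma3, potQ, Matrix.mul_apply, Fin.sum_univ_two, vecMul, dotProduct, e0]
    ring
  · convert hm 1 0 using 1
    simp [sigma3, potQ, Matrix.mul_apply, Fin.sum_univ_two, vecMul, dotProduct, t0]
    ring

end IsDressing

end Darboux

/-! ### Bäcklund formulas and the new solution -/

section DarbouxTheorem

variable {ι : Type*} [Fintype ι] [DecidableEq ι]

namespace IsDressing

variable {a σ : ℝ} {ρ : ℤ → ℝ → ℝ} {q : ℤ → ℝ → ℂ} {Λ : Matrix ι ι ℂ}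
  {Y : ℤ → ℝ → Matrix (Fin 2) ι ℂ} {M : ℤ → ℝ → Matrix ι ι ℂ}

theorem isDarbouxMatrix (h : IsDressing a σ ρ q Λ Y M) (ha : a ≠ 0) {poles : Set ℂ}
    {R : ℂ → Matrix ι ι ℂ} (hR : ∀ z ∉ poles, R z * (z • 1 - Λᴴ) = 1) :
    IsDarbouxMatrix a σ ρ q (dressedRho a σ ρ Y M) (dressedQ σ q Y M) poles
      (fun n s => (M n s).det)
      (fun z n s => 1 + Y n s * (M n s)⁻¹ * R z * (Y n s)ᴴ * J σ) := by
  have hT : (fun z n s => 1 + Y n s * (M n s)⁻¹ * R z * (Y n s)ᴴ * J σ) =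
      fun z n s => 1 + moment σ (Y n s) (M n s) (R z) := by
    funext z n s
    rw [moment, Matrix.mul_assoc _ _ (J σ)]
  rw [hT]
  intro z hz hzp n s h0
  have hU := fun h1 => h.darboux_shift ha h0 h1 hz (hR z hzp)
  have hV := h.darboux_hasMatDerivAt h0 (hR z hzp)
  refine ⟨hU, hV, fun Ψ hΨ => ⟨fun h1 => ?_, ?_⟩⟩
  · rw [hΨ.1, mulVec_mulVec, mulVec_mulVec, hU h1]
  · convert hV.mulVec (hΨ.2 n s) using 1
    rw [mulVec_mulVec, mulVec_mulVec, ← add_mulVec]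
    congr 1
    abel

theorem differentiableAt_det (h : IsDressing a σ ρ q Λ Y M) (n : ℤ) (s : ℝ) :
    DifferentiableAt ℝ (fun t => (M n t).det) s :=
  (h.hasMatDerivAt_M n s).det.differentiableAt

theorem logDeriv_det_hasDerivAt (h : IsDressing a σ ρ q Λ Y M) {n : ℤ} {s : ℝ}
    (h0 : (M n s).det ≠ 0) :
    HasDerivAt (logDeriv fun t => (M n t).det)
      (σ / 4 * ((‖dressedQ σ q Y M n s‖ ^ 2 : ℝ) - (‖q n s‖ ^ 2 : ℝ))) s := by
  have h1 := (((h.residue_hasDerivAt h0).1.const_mul 2).sub_const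
    (Λᴴ.trace - Λ.trace)).const_mul (-(Complex.I / 4))
  refine (h1.congr_of_eventuallyEq ?_).congr_deriv ?_
  · filter_upwards [(h.differentiableAt_det n s).continuousAt.eventually_ne h0] with t ht
    exact h.logDeriv_det_eq ht
  · linear_combination (-(σ / 4) * (((‖dressedQ σ q Y M n s‖ ^ 2 : ℝ) : ℂ) -
      (‖q n s‖ ^ 2 : ℝ))) * Complex.I_mul_I

theorem backlundFormulas (h : IsDressing a σ ρ q Λ Y M) (hσ : σ * σ = 1) :
    BacklundFormulas a σ ρ q (dressedRho a σ ρ Y M) (dressedQ σ q Y M)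
      (fun n s => (M n s).det) (fun n s => (matG (Y n s) (M n s)).det) := by
  intro n s h0
  have hl := h.logDeriv_det_hasDerivAt h0
  refine ⟨h.differentiableAt_det n s, hl.differentiableAt, fun h1 => ?_, ?_, ?_⟩
  · rw [logDeriv_div s h1 h0 (h.differentiableAt_det _ s) (h.differentiableAt_det n s),
      h.logDeriv_det_eq h0, h.logDeriv_det_eq h1, h.ofReal_dressedRho]
    ring
  · rw [dressedQ, det_matG σ _ h0]
  · rw [hl.deriv]
    have hσ' : (σ : ℂ) * σ = 1 := by exact_mod_cast hσ
    linear_combination (-((‖dressedQ σ q Y M n s‖ ^ 2 : ℝ) - (‖q n s‖ ^ 2 : ℝ) : ℂ)) * hσ'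

/-- A direct verification. In the first equation the moments of `Λ†` at `n + 1` and `n` enter only
through their difference, which `moment_shift` with `C = 1` expresses by residues. The second
follows from the derivative of `R₀₀`. -/
theorem solvesAgain (h : IsDressing a σ ρ q Λ Y M) (ha : a ≠ 0)
    (hq : ∀ n, Differentiable ℝ (q n)) (hsol : ∀ n s, SolvesAt a σ ρ q n s) :
    SolvesAgain a σ (dressedRho a σ ρ Y M) (dressedQ σ q Y M) (fun n s => (M n s).det) := by
  have ha' : (a : ℂ) ≠ 0 := by exact_mod_cast ha
  intro n s h0
  refine ⟨(hq n s).add (h.residue_hasDerivAt h0).2.differentiableAt, fun h1 => ⟨?_, ?_⟩⟩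
  · have hd := ((hsol n s).1.add (h.residue_hasDerivAt h1).2).sub (h.residue_hasDerivAt h0).2
    refine (hd.congr_of_eventuallyEq (.of_forall fun t => ?_)).congr_deriv ?_
    · simp only [dressedQ, Pi.add_apply, Pi.sub_apply]
      ring
    · have hW := congrFun (congrFun (h.moment_shift h0 h1 (C := 1) (by simp)) 1) 0
      simp only [Matrix.mul_one, moment_one, Matrix.add_apply, Matrix.sub_apply, Matrix.mul_apply,
        Fin.sum_univ_two, h.trace_residue h0, h.trace_residue h1] at hW
      simp only [laxA, of_apply, cons_val', cons_val_zero, cons_val_one, cons_val_fin_one] at hW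
      have hρ : (a : ℂ) * dressedRho a σ ρ Y M n s = a * ρ n s + Complex.I *
          (residue σ (Y (n + 1) s) (M (n + 1) s) 0 0 - residue σ (Y n s) (M n s) 0 0) := by
        rw [h.ofReal_dressedRho]
        field_simp
      rw [hρ]
      simp only [dressedQ]
      linear_combination (-(Complex.I / 2)) * hW - (a * ρ n s / 2 *
        (residue σ (Y (n + 1) s) (M (n + 1) s) 1 0 + residue σ (Y n s) (M n s) 1 0)) *
          Complex.I_mul_I
  · have hρ : ∀ t, ((a * dressedRho a σ ρ Y M n t : ℝ) : ℂ) = (a * ρ n t : ℝ) + Complex.I *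
          (residue σ (Y (n + 1) t) (M (n + 1) t) 0 0 - residue σ (Y n t) (M n t) 0 0) := by
      intro t
      rw [Complex.ofReal_mul, h.ofReal_dressedRho, Complex.ofReal_mul]
      field_simp
    have hd := (hsol n s).2.ofReal_comp.add
      (((h.residue_hasDerivAt h1).1.sub (h.residue_hasDerivAt h0).1).const_mul Complex.I)
    have hd' : HasDerivAt (fun t => ((a * dressedRho a σ ρ Y M n t : ℝ) : ℂ))
        ((-(σ / 2) * (‖dressedQ σ q Y M (n + 1) s‖ ^ 2 - ‖dressedQ σ q Y M n s‖ ^ 2) : ℝ) : ℂ)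
        s := by
      refine (hd.congr_of_eventuallyEq (.of_forall hρ)).congr_deriv ?_
      push_cast
      linear_combination (σ / 2 * ((‖dressedQ σ q Y M (n + 1) s‖ ^ 2 - ‖q (n + 1) s‖ ^ 2) -
        (‖dressedQ σ q Y M n s‖ ^ 2 - ‖q n s‖ ^ 2)) : ℂ) * Complex.I_mul_I
    -- The equation was derived in `ℂ`, where the residue lives; both sides are casts of reals, so
    -- the real part recovers it.
    exact Complex.reCLM.hasFDerivAt.comp_hasDerivAt s hd'

/-- A dressing yields a Darboux transformation. -/
theorem exists_darboux (h : IsDressing a σ ρ q Λ Y M) (ha : a ≠ 0) (hσ : σ * σ = 1)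
    (hq : ∀ n, Differentiable ℝ (q n)) (hsol : ∀ n s, SolvesAt a σ ρ q n s) {poles : Set ℂ}
    {R : ℂ → Matrix ι ι ℂ} (hR : ∀ z ∉ poles, R z * (z • 1 - Λᴴ) = 1) :
    ∃ (ρN : ℤ → ℝ → ℝ) (qN : ℤ → ℝ → ℂ),
      IsDarbouxMatrix a σ ρ q ρN qN poles (fun n s => (M n s).det)
        (fun z n s => 1 + Y n s * (M n s)⁻¹ * R z * (Y n s)ᴴ * J σ) ∧
      BacklundFormulas a σ ρ q ρN qN (fun n s => (M n s).det)
        (fun n s => (matG (Y n s) (M n s)).det) ∧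
      SolvesAgain a σ ρN qN (fun n s => (M n s).det) :=
  ⟨dressedRho a σ ρ Y M, dressedQ σ q Y M, h.isDarbouxMatrix ha hR, h.backlundFormulas hσ,
    h.solvesAgain ha hq hsol⟩

end IsDressing

end DarbouxTheorem

/-! ### The `N`-fold case: diagonal `Λ` -/

section NFoldDressing

variable {ι : Type*} [Fintype ι] [DecidableEq ι]

theorem nfold_sylvester_inj {lam : ι → ℂ} (hlam : ∀ i j, star (lam i) ≠ lam j)
    (X : Matrix ι ι ℂ) (hX : (diagonal lam)ᴴ * X = X * diagonal lam) : X = 0 := by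
  ext i j
  have h := congrFun (congrFun hX i) j
  rw [diagonal_conjTranspose, diagonal_mul, mul_diagonal, mul_comm, ← sub_eq_zero, ← mul_sub,
    mul_eq_zero] at h
  exact h.resolve_right (sub_ne_zero.2 (hlam i j))

theorem bracket_eq (σ : ℝ) (u v : Fin 2 → ℂ) :
    bracket σ u v = star (u 0) * v 0 + σ * (star (u 1) * v 1) := by
  simp [bracket, J, dotProduct, mulVec, Fin.sum_univ_two]
  ring

theorem conjTranspose_mul_J_mul_apply {κ : Type*} (σ : ℝ) (Y : Matrix (Fin 2) κ ℂ) (p p' : κ) :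
    (Yᴴ * J σ * Y) p p' = bracket σ (fun x => Y x p) (fun x => Y x p') := by
  rw [bracket_eq]
  simp [J, Matrix.mul_apply, Fin.sum_univ_two]
  ring

theorem nfold_sylvester (σ : ℝ) {lam : ι → ℂ} (hlam : ∀ i j, star (lam i) ≠ lam j)
    (v : ι → Fin 2 → ℂ) :
    (diagonal lam)ᴴ * nfoldM σ lam v - nfoldM σ lam v * diagonal lam =
      (nfoldY v)ᴴ * J σ * nfoldY v := by
  ext i j
  rw [conjTranspose_mul_J_mul_apply, Matrix.sub_apply, diagonal_conjTranspose, diagonal_mul,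
    mul_diagonal]
  have h := sub_ne_zero.2 (hlam i j)
  simp only [nfoldM, nfoldY, of_apply, Pi.star_apply]
  field_simp

theorem mulVec_apply_two {m : Type*} (A : Matrix m (Fin 2) ℂ) (v : Fin 2 → ℂ) (x : m) :
    (A *ᵥ v) x = A x 0 * v 0 + A x 1 * v 1 := by
  rw [mulVec, dotProduct, Fin.sum_univ_two]

theorem laxV_mulVec_apply (σ : ℝ) (q : ℤ → ℝ → ℂ) (z : ℂ) (n : ℤ) (s : ℝ) (v : Fin 2 → ℂ)
    (x : Fin 2) :
    (laxV σ q z n s *ᵥ v) x = Complex.I / 4 * (z * (sigma3 x 0 * v 0 + sigma3 x 1 * v 1)) +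
      Complex.I / 2 * (potQ σ (q n s) x 0 * v 0 + potQ σ (q n s) x 1 * v 1) := by
  rw [laxV_eq, mulVec_apply_two]
  simp only [Matrix.add_apply, Matrix.smul_apply, smul_eq_mul]
  ring

theorem laxU_mulVec_apply {z : ℂ} (hz : z ≠ 0) (a σ : ℝ) (ρ : ℤ → ℝ → ℝ) (q : ℤ → ℝ → ℂ) (n : ℤ)
    (s : ℝ) (v : Fin 2 → ℂ) (x : Fin 2) :
    z * (laxU a σ ρ q z n s *ᵥ v) x =
      z * v x + (laxA a σ ρ q n s x 0 * v 0 + laxA a σ ρ q n s x 1 * v 1) := by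
  rw [laxU_eq, add_mulVec, one_mulVec, smul_mulVec, Pi.add_apply, Pi.smul_apply, smul_eq_mul,
    mul_add, mul_inv_cancel_left₀ hz, mulVec_apply_two]

theorem nfold_isDressing {a σ : ℝ} {ρ : ℤ → ℝ → ℝ} {q : ℤ → ℝ → ℂ} {lam : ι → ℂ}
    {y : ι → ℤ → ℝ → Fin 2 → ℂ} (hlam : ∀ i j, star (lam i) ≠ lam j)
    (hy : ∀ i, IsLaxSolution a σ ρ q (lam i) (y i)) :
    IsDressing a σ ρ q (diagonal lam) (fun n s => nfoldY fun i => y i n s)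
      (fun n s => nfoldM σ lam fun i => y i n s) := by
  -- Taking `i = j` in the hypothesis excludes real spectral points, in particular the pole `0` of
  -- the spatial Lax matrix.
  have hlam0 : ∀ i, lam i ≠ 0 := fun i h => hlam i i (by simp [h])
  refine ⟨nfold_sylvester_inj hlam, fun n s => nfold_sylvester σ hlam _, fun n s => ?_,
    fun n s x p => ?_, fun n s => ?_⟩
  · ext x p
    rw [Matrix.add_apply, mul_diagonal, mul_diagonal]
    have h := laxU_mulVec_apply (hlam0 p) a σ ρ q n s (y p n s) x
    rw [← (hy p).1] at h
    simpa [nfoldY, Matrix.mul_apply, Fin.sum_univ_two, mul_comm] using h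
  · refine (hasDerivAt_pi.1 ((hy p).2 n s) x).congr_deriv ?_
    rw [laxV_mulVec_apply, Matrix.add_apply, Matrix.smul_apply, Matrix.smul_apply, mul_diagonal]
    simp only [nfoldY, Matrix.mul_apply, Fin.sum_univ_two, of_apply, smul_eq_mul]
    ring
  · have hd : ∀ p x, DifferentiableAt ℝ (fun t => y p n t x) s := fun p x =>
      (hasDerivAt_pi.1 ((hy p).2 n s) x).differentiableAt
    refine ⟨of fun p p' => deriv (fun t => nfoldM σ lam (fun i => y i n t) p p') s,
      fun p p' => DifferentiableAt.hasDerivAt ?_⟩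
    simp only [nfoldM, of_apply, bracket_eq]
    exact ((((hd p 0).star.mul (hd p' 0)).add
      (((hd p 1).star.mul (hd p' 1)).const_mul _))).div_const _

theorem nfold_resolvent {lam : ι → ℂ} {z : ℂ} (hz : ∀ i, z ≠ star (lam i)) :
    (diagonal fun p => z - star (lam p))⁻¹ * (z • 1 - (diagonal lam)ᴴ) = 1 := by
  have h : z • 1 - (diagonal lam)ᴴ = diagonal fun p => z - star (lam p) := by
    rw [diagonal_conjTranspose, smul_one_eq_diagonal, diagonal_sub]
    rfl
  rw [h]
  refine nonsing_inv_mul _ (isUnit_iff_ne_zero.2 ?_)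
  rw [det_diagonal]
  exact Finset.prod_ne_zero_iff.2 fun i _ => sub_ne_zero.2 (hz i)

end NFoldDressing

/-! ### Taylor coefficients and divided differences as Cauchy integrals -/

section TaylorCoeff

open Complex Metric

variable {f g : ℂ → ℂ}

theorem taylorCoeff_congr (h : f =ᶠ[𝓝 0] g) (k : ℕ) : taylorCoeff f k = taylorCoeff g k := by
  rw [taylorCoeff, taylorCoeff, h.iteratedDeriv_eq]

theorem taylorCoeff_zero (f : ℂ → ℂ) : taylorCoeff f 0 = f 0 := by
  simp [taylorCoeff]

theorem taylorCoeff_add (hf : AnalyticAt ℂ f 0) (hg : AnalyticAt ℂ g 0) (k : ℕ) :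
    taylorCoeff (fun ε => f ε + g ε) k = taylorCoeff f k + taylorCoeff g k := by
  have h := iteratedDeriv_add (n := k) hf.contDiffAt hg.contDiffAt
  rw [taylorCoeff, taylorCoeff, taylorCoeff, ← add_div, ← h]
  rfl

theorem taylorCoeff_const_mul (c : ℂ) (f : ℂ → ℂ) (k : ℕ) :
    taylorCoeff (fun ε => c * f ε) k = c * taylorCoeff f k := by
  rw [taylorCoeff, taylorCoeff, iteratedDeriv_const_mul_field, mul_div_assoc]

theorem taylorCoeff_linear (hf : AnalyticAt ℂ f 0) (hg : AnalyticAt ℂ g 0) (c d : ℂ) (k : ℕ) :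
    taylorCoeff (fun ε => c * f ε + d * g ε) k = c * taylorCoeff f k + d * taylorCoeff g k := by
  rw [taylorCoeff_add (f := fun ε => c * f ε) (g := fun ε => d * g ε) (analyticAt_const.mul hf)
    (analyticAt_const.mul hg), taylorCoeff_const_mul, taylorCoeff_const_mul]

theorem taylorCoeff_const_succ (c : ℂ) (k : ℕ) : taylorCoeff (fun _ => c) (k + 1) = 0 := by
  simp [taylorCoeff, iteratedDeriv_const]

theorem taylorCoeff_id_mul_zero (f : ℂ → ℂ) : taylorCoeff (fun ε => ε * f ε) 0 = 0 := by
  simp [taylorCoeff]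

theorem taylorCoeff_id_mul_succ (hf : AnalyticAt ℂ f 0) (k : ℕ) :
    taylorCoeff (fun ε => ε * f ε) (k + 1) = taylorCoeff f k := by
  have h : iteratedDeriv (k + 1) (fun ε => ε * f ε) 0 = (k + 1) * iteratedDeriv k f 0 := by
    rw [iteratedDeriv_fun_mul (f := fun ε => ε) contDiffAt_fun_id hf.contDiffAt,
      Finset.sum_eq_single 1]
    · simp [iteratedDeriv_one]
    · intro i _ hi
      rcases i with _ | _ | i
      · simp
      · exact absurd rfl hi
      · have : iteratedDeriv (i + 1 + 1) (fun x : ℂ => x) 0 = 0 := by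
          rw [iteratedDeriv_succ']
          simp [iteratedDeriv_const]
        simp [this]
    · simp
  rw [taylorCoeff, h, taylorCoeff, Nat.factorial_succ]
  push_cast
  have h1 : (k : ℂ) + 1 ≠ 0 := by exact_mod_cast k.succ_ne_zero
  rw [mul_div_mul_left _ _ h1]

/-- This is how a Jordan block arises: multiplication by `ε` shifts the coefficients by one. -/
theorem taylorCoeff_affine_mul (hf : AnalyticAt ℂ f 0) (c d : ℂ) (k : ℕ) :
    taylorCoeff (fun ε => (c + d * ε) * f ε) k =
      c * taylorCoeff f k + d * taylorCoeff (fun ε => ε * f ε) k := by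
  have e : (fun ε => (c + d * ε) * f ε) = fun ε => c * f ε + d * (ε * f ε) := by
    funext ε
    ring
  rw [e, taylorCoeff_linear hf (g := fun ε => ε * f ε) (analyticAt_id.mul hf)]

theorem taylorCoeff_star_star (f : ℂ → ℂ) (k : ℕ) :
    taylorCoeff (fun ε => star (f (star ε))) k = star (taylorCoeff f k) := by
  have h : ∀ k, ∀ f : ℂ → ℂ, iteratedDeriv k (fun ε => star (f (star ε))) =
      fun ε => star (iteratedDeriv k f (star ε)) := by
    intro k
    induction k with
    | zero => simp
    | succ k ih =>
      intro f
      have hd : deriv (fun ε => star (f (star ε))) = fun ε => star (deriv f (star ε)) :=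
        deriv_conj_conj
      rw [iteratedDeriv_succ', iteratedDeriv_succ', hd, ih]
  rw [taylorCoeff, taylorCoeff, h]
  simp

theorem analyticAt_star_star (hf : AnalyticAt ℂ f 0) :
    AnalyticAt ℂ (fun ε => star (f (star ε))) 0 := by
  rw [analyticAt_iff_eventually_differentiableAt] at hf ⊢
  have h : Tendsto (star : ℂ → ℂ) (𝓝 0) (𝓝 0) := by
    simpa using (continuous_star (R := ℂ)).tendsto 0
  filter_upwards [h.eventually hf] with z hz
  simpa [Function.comp_def] using hz.star_star

theorem taylorCoeff_eq_circleIntegral {R : ℝ} (hR : 0 < R)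
    (hf : DifferentiableOn ℂ f (closedBall 0 R)) (k : ℕ) :
    taylorCoeff f k = (2 * Real.pi * I)⁻¹ * ∮ w in C(0, R), f w / w ^ (k + 1) := by
  lift R to NNReal using hR.le
  have h1 := (hf.hasFPowerSeriesOnBall (by exact_mod_cast hR)).hasFPowerSeriesAt
  have h2 := h1.analyticAt.hasFPowerSeriesAt
  have h3 := congrArg (fun p => p.coeff k) (h2.eq_formalMultilinearSeries h1)
  simp only [FormalMultilinearSeries.coeff_ofScalars] at h3
  rw [taylorCoeff, h3, FormalMultilinearSeries.coeff]
  have h4 := cauchyPowerSeries_apply f 0 R k 1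
  have e : (1 : Fin k → ℂ) = fun _ => 1 := rfl
  rw [e, h4, smul_eq_mul]
  congr 1
  refine congrArg (fun F => circleIntegral F 0 R) (funext fun w => ?_)
  simp only [sub_zero, smul_eq_mul, pow_succ, div_eq_mul_inv, mul_inv]
  ring

/-- Differentiation under the Cauchy integral. A bound for the time derivative on the circle
suffices for domination, so no joint regularity is needed. -/
theorem hasDerivAt_taylorCoeff {F F' : ℂ → ℝ → ℂ} {R C s : ℝ} {u : Set ℝ} (hR : 0 < R)
    (hu : u ∈ 𝓝 s) (hF : ∀ t, DifferentiableOn ℂ (F · t) (closedBall 0 R))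
    (hF' : DifferentiableOn ℂ (F' · s) (closedBall 0 R))
    (hd : ∀ w ∈ closedBall (0 : ℂ) R, ∀ t, HasDerivAt (F w) (F' w t) t)
    (hC : ∀ w ∈ sphere (0 : ℂ) R, ∀ t ∈ u, ‖F' w t‖ ≤ C) (k : ℕ) :
    HasDerivAt (fun t => taylorCoeff (F · t) k) (taylorCoeff (F' · s) k) s := by
  simp only [taylorCoeff_eq_circleIntegral hR (hF _), taylorCoeff_eq_circleIntegral hR hF']
  refine HasDerivAt.const_mul _ ?_
  have hmem : ∀ θ, circleMap 0 R θ ∈ sphere (0 : ℂ) R := circleMap_mem_sphere 0 hR.le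
  have hne : ∀ θ, circleMap 0 R θ ^ (k + 1) ≠ 0 := fun θ =>
    pow_ne_zero _ (circleMap_ne_center hR.ne')
  have hdc : Continuous fun θ => deriv (circleMap 0 R) θ := by
    simp only [deriv_circleMap]
    fun_prop
  have hcont : ∀ G : ℂ → ℂ, DifferentiableOn ℂ G (closedBall 0 R) →
      Continuous fun θ => deriv (circleMap 0 R) θ • (G (circleMap 0 R θ) /
        circleMap 0 R θ ^ (k + 1)) := by
    intro G hG
    have h1 : Continuous fun θ => G (circleMap 0 R θ) :=
      hG.continuousOn.comp_continuous (continuous_circleMap 0 R)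
        fun θ => sphere_subset_closedBall (hmem θ)
    exact hdc.smul (h1.div ((continuous_circleMap 0 R).pow _) hne)
  simp only [circleIntegral]
  refine (intervalIntegral.hasDerivAt_integral_of_dominated_loc_of_deriv_le
    (F' := fun t θ => deriv (circleMap 0 R) θ • (F' (circleMap 0 R θ) t /
        circleMap 0 R θ ^ (k + 1)))
    (bound := fun _ => R * (C / R ^ (k + 1))) hu
    (.of_forall fun t => (hcont _ (hF t)).aestronglyMeasurable)
    ((hcont _ (hF s)).intervalIntegrable _ _)
    (hcont _ hF').aestronglyMeasurable
    (.of_forall fun θ _ t ht => ?_) (by simp) (.of_forall fun θ _ t _ => ?_)).2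
  · simp only [deriv_circleMap, norm_smul, norm_mul, norm_circleMap_zero, norm_I, mul_one,
      norm_div, norm_pow, abs_of_pos hR]
    gcongr
    exact hC _ (hmem θ) t ht
  · exact ((hd _ (sphere_subset_closedBall (hmem θ)) t).div_const _).const_smul
      (deriv (circleMap 0 R) θ)

/-- The divided difference of `f` at the nodes `e 0, …, e k`, as a Cauchy integral. -/
def dividedDiff (R : ℝ) (f : ℂ → ℂ) (e : ℕ → ℂ) (k : ℕ) : ℂ :=
  (2 * Real.pi * I)⁻¹ * ∮ w in C(0, R), f w / ∏ l ∈ Finset.range (k + 1), (w - e l)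

/-- Once the nodes have modulus below `R / 2`, every factor `w - e j` on the circle has modulus at
least `R / 2`, and dominated convergence applies. -/
theorem tendsto_dividedDiff {X : Type*} {l : Filter X} [l.IsCountablyGenerated] {R : ℝ}
    (hR : 0 < R) (hf : DifferentiableOn ℂ f (closedBall 0 R)) {e : X → ℕ → ℂ}
    (he : ∀ j, Tendsto (fun ε => e ε j) l (𝓝 0)) (k : ℕ) :
    Tendsto (fun ε => dividedDiff R f (e ε) k) l (𝓝 (taylorCoeff f k)) := by
  rw [taylorCoeff_eq_circleIntegral hR hf]
  refine Tendsto.const_mul _ ?_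
  have hmem : ∀ θ, circleMap 0 R θ ∈ sphere (0 : ℂ) R := circleMap_mem_sphere 0 hR.le
  have hdc : Continuous fun θ => deriv (circleMap 0 R) θ := by
    simp only [deriv_circleMap]
    fun_prop
  have hfc : Continuous fun θ => f (circleMap 0 R θ) :=
    hf.continuousOn.comp_continuous (continuous_circleMap 0 R)
      fun θ => sphere_subset_closedBall (hmem θ)
  obtain ⟨C, hC⟩ := (isCompact_sphere (0 : ℂ) R).exists_bound_of_continuousOn
    (hf.continuousOn.mono sphere_subset_closedBall)
  have hsmall : ∀ᶠ ε in l, ∀ j ∈ Finset.range (k + 1), ‖e ε j‖ < R / 2 := by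
    rw [Filter.eventually_all_finset]
    intro j _
    have := (he j).norm
    rw [norm_zero] at this
    exact this.eventually_lt_const (by positivity)
  have hfar : ∀ ε : X, (∀ j ∈ Finset.range (k + 1), ‖e ε j‖ < R / 2) → ∀ θ,
      ∀ j ∈ Finset.range (k + 1), R / 2 ≤ ‖circleMap 0 R θ - e ε j‖ := by
    intro ε hε θ j hj
    have h1 := norm_sub_norm_le (circleMap 0 R θ) (e ε j)
    rw [norm_circleMap_zero, abs_of_pos hR] at h1
    linarith [hε j hj]
  simp only [circleIntegral]
  refine intervalIntegral.tendsto_integral_filter_of_dominated_convergence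
    (fun _ => R * (C / ∏ _j ∈ Finset.range (k + 1), (R / 2))) ?_ ?_ (by simp) ?_
  · filter_upwards [hsmall] with ε hε
    refine (hdc.smul (hfc.div (by fun_prop) fun θ => ?_)).aestronglyMeasurable
    exact Finset.prod_ne_zero_iff.2 fun j hj =>
      norm_pos_iff.1 (lt_of_lt_of_le (by positivity) (hfar ε hε θ j hj))
  · filter_upwards [hsmall] with ε hε
    refine .of_forall fun θ _ => ?_
    simp only [deriv_circleMap, norm_smul, norm_mul, norm_circleMap_zero, norm_I, mul_one,
      norm_div, norm_prod, abs_of_pos hR]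
    gcongr with j hj
    · exact (norm_nonneg _).trans (hC _ (hmem θ))
    · exact hC _ (hmem θ)
    · exact hfar ε hε θ j hj
  · refine .of_forall fun θ _ => Tendsto.const_smul ?_ _
    have h1 : Tendsto (fun ε => ∏ j ∈ Finset.range (k + 1), (circleMap 0 R θ - e ε j)) l
        (𝓝 (circleMap 0 R θ ^ (k + 1))) := by
      have := tendsto_finsetProd (Finset.range (k + 1)) fun j _ =>
        (he j).const_sub (circleMap 0 R θ)
      simpa using this
    exact tendsto_const_nhds.div h1 (pow_ne_zero _ (circleMap_ne_center hR.ne'))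

/-- Newton expansion of the Cauchy kernel with remainder. At a node among the first `K` the
remainder vanishes, which makes interpolation exact there. -/
theorem one_div_sub_eq_sum_newton {w x : ℂ} {e : ℕ → ℂ} (hx : w - x ≠ 0) (K : ℕ)
    (he : ∀ l < K, w - e l ≠ 0) :
    1 / (w - x) = ∑ k ∈ Finset.range K, (∏ l ∈ Finset.range k, (x - e l)) /
        (∏ l ∈ Finset.range (k + 1), (w - e l)) +
      (∏ l ∈ Finset.range K, (x - e l)) / ((∏ l ∈ Finset.range K, (w - e l)) * (w - x)) := by
  induction K with
  | zero => simp
  | succ K ih =>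
    have h1 : ∏ l ∈ Finset.range K, (w - e l) ≠ 0 :=
      Finset.prod_ne_zero_iff.2 fun l hl => he l (by simp at hl; omega)
    have h2 := he K (by omega)
    rw [ih fun l hl => he l (by omega), Finset.sum_range_succ, add_assoc, add_right_inj,
      Finset.prod_range_succ, Finset.prod_range_succ]
    field_simp
    ring

theorem sum_dividedDiff_mul_prod {R : ℝ} (hR : 0 < R)
    (hf : DifferentiableOn ℂ f (closedBall 0 R)) {e : ℕ → ℂ} {K j : ℕ} (hj : j < K)
    (he : ∀ l < K, ‖e l‖ < R) :
    ∑ k ∈ Finset.range K, dividedDiff R f e k * ∏ l ∈ Finset.range k, (e j - e l) = f (e j) := by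
  have hne : ∀ w ∈ sphere (0 : ℂ) R, ∀ l < K, w - e l ≠ 0 := by
    intro w hw l hl h0
    have h1 := he l hl
    rw [← sub_eq_zero.1 h0, mem_sphere_zero_iff_norm.1 hw] at h1
    exact lt_irrefl _ h1
  have hprod : ∀ k < K, ∀ w ∈ sphere (0 : ℂ) R, ∏ l ∈ Finset.range (k + 1), (w - e l) ≠ 0 :=
    fun k hk w hw => Finset.prod_ne_zero_iff.2 fun l hl =>
      hne w hw l (by simp at hl; omega)
  have h1 := hf.circleIntegral_sub_inv_smul (w := e j) (by simpa using he j hj)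
  have h2 : (∮ w in C(0, R), (w - e j)⁻¹ • f w) = ∮ w in C(0, R), ∑ k ∈ Finset.range K,
      (∏ l ∈ Finset.range k, (e j - e l)) *
        (f w / ∏ l ∈ Finset.range (k + 1), (w - e l)) := by
    refine circleIntegral.integral_congr hR.le fun w hw => ?_
    have h3 := one_div_sub_eq_sum_newton (hne w hw j hj) K (hne w hw)
    rw [Finset.prod_eq_zero (Finset.mem_range.2 hj) (sub_self (e j)), zero_div, add_zero,
      one_div] at h3
    simp only [h3, smul_eq_mul, Finset.sum_mul]
    exact Finset.sum_congr rfl fun k _ => by ring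
  rw [h2, circleIntegral.integral_fun_sum] at h1
  · simp only [circleIntegral.integral_const_mul] at h1
    have h4 : (2 * Real.pi * I : ℂ) ≠ 0 := two_pi_I_ne_zero
    rw [smul_eq_mul] at h1
    rw [← mul_right_inj' h4, ← h1, Finset.mul_sum]
    refine Finset.sum_congr rfl fun k _ => ?_
    rw [dividedDiff]
    field_simp
  · intro k hk
    refine ContinuousOn.circleIntegrable hR.le (continuousOn_const.mul
      ((hf.continuousOn.mono sphere_subset_closedBall).div (by fun_prop)
        (hprod k (Finset.mem_range.1 hk))))

end TaylorCoeff

/-! ### Bidiagonal matrices and their Sylvester equations -/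

section Jordan

variable {r : ℕ} {m : Fin r → ℕ}

/-- The family shifted by one step within each group, with zeros filled in. -/
def prevEntry (F : Idx m → ℂ) : Idx m → ℂ
  | ⟨_, ⟨0, _⟩⟩ => 0
  | ⟨i, ⟨k + 1, h⟩⟩ => F ⟨i, ⟨k, Nat.lt_of_succ_lt h⟩⟩

/-- The block-diagonal upper bidiagonal matrix with diagonal `d` and the entries `α i` above the
diagonal of the `i`-th block. -/
def jordan (α : Fin r → ℂ) (d : Idx m → ℂ) : Matrix (Idx m) (Idx m) ℂ :=
  diagonal d + of fun p p' => α p'.1 * prevEntry (fun p'' => if p = p'' then 1 else 0) p'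

theorem mul_jordan_apply {κ : Type*} (α : Fin r → ℂ) (d : Idx m → ℂ) (X : Matrix κ (Idx m) ℂ)
    (x : κ) (p : Idx m) :
    (X * jordan α d) x p = X x p * d p + α p.1 * prevEntry (X x) p := by
  rw [jordan, Matrix.mul_add, Matrix.add_apply, mul_diagonal, add_right_inj]
  obtain ⟨i, ⟨_ | k, hk⟩⟩ := p <;> simp [Matrix.mul_apply, prevEntry, mul_comm]

theorem prevEntry_star (F : Idx m → ℂ) (p : Idx m) :
    prevEntry (fun p => star (F p)) p = star (prevEntry F p) := by
  obtain ⟨i, ⟨_ | k, hk⟩⟩ := p <;> simp [prevEntry]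

theorem jordan_conjTranspose_mul_apply {κ : Type*} (α : Fin r → ℂ) (d : Idx m → ℂ)
    (X : Matrix (Idx m) κ ℂ) (p : Idx m) (x : κ) :
    ((jordan α d)ᴴ * X) p x =
      star (d p) * X p x + star (α p.1) * prevEntry (fun p => X p x) p := by
  have h : (jordan α d)ᴴ * X = (Xᴴ * jordan α d)ᴴ := by simp
  rw [h, conjTranspose_apply, mul_jordan_apply, star_add, star_mul', star_mul', ← prevEntry_star]
  simp [mul_comm]

theorem sylvester_jordan_apply {α : Fin r → ℂ} {d : Idx m → ℂ} {X B : Matrix (Idx m) (Idx m) ℂ}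
    (h : (jordan α d)ᴴ * X - X * jordan α d = B) {p p' : Idx m} (hd : star (d p) ≠ d p') :
    X p p' = (B p p' - star (α p.1) * prevEntry (fun p => X p p') p +
      α p'.1 * prevEntry (X p) p') / (star (d p) - d p') := by
  have h1 := congrFun (congrFun h p) p'
  rw [Matrix.sub_apply, jordan_conjTranspose_mul_apply, mul_jordan_apply] at h1
  rw [eq_div_iff (sub_ne_zero.2 hd), ← h1]
  ring

/-- An entry of the solution is determined by its predecessors in row and column, so the sum of the
two positions inside the groups decreases. -/
theorem sylvester_jordan_induction {P : Idx m → Idx m → Prop}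
    (h : ∀ p p', (∀ r : Idx m, (r.2 : ℕ) < p.2 → P r p') → (∀ r : Idx m, (r.2 : ℕ) < p'.2 → P p r) →
      P p p') (p p' : Idx m) : P p p' := by
  induction hN : (p.2 : ℕ) + p'.2 using Nat.strong_induction_on generalizing p p' with
  | _ N ih =>
    exact h p p' (fun r hr => ih _ (by omega) r p' rfl) fun r hr => ih _ (by omega) p r rfl

theorem tendsto_prevEntry {X : Type*} {l : Filter X} {F : X → Idx m → ℂ} {F₀ : Idx m → ℂ}
    {p : Idx m} (h : ∀ p' : Idx m, (p'.2 : ℕ) < p.2 → Tendsto (fun ε => F ε p') l (𝓝 (F₀ p'))) :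
    Tendsto (fun ε => prevEntry (F ε) p) l (𝓝 (prevEntry F₀ p)) := by
  obtain ⟨i, ⟨_ | k, hk⟩⟩ := p
  · exact tendsto_const_nhds
  · exact h _ k.lt_succ_self

/-- The solution of the Sylvester equation depends continuously on the data. -/
theorem tendsto_sylvester_jordan {X : Type*} {l : Filter X} {α : Fin r → ℂ} {d : X → Idx m → ℂ}
    {d₀ : Idx m → ℂ} {A B : X → Matrix (Idx m) (Idx m) ℂ} {A₀ B₀ : Matrix (Idx m) (Idx m) ℂ}
    (hd₀ : ∀ p p', star (d₀ p) ≠ d₀ p') (hd : ∀ p, Tendsto (fun ε => d ε p) l (𝓝 (d₀ p)))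
    (hB : ∀ p p', Tendsto (fun ε => B ε p p') l (𝓝 (B₀ p p')))
    (hA : ∀ᶠ ε in l, (jordan α (d ε))ᴴ * A ε - A ε * jordan α (d ε) = B ε)
    (hA₀ : (jordan α d₀)ᴴ * A₀ - A₀ * jordan α d₀ = B₀) (p p' : Idx m) :
    Tendsto (fun ε => A ε p p') l (𝓝 (A₀ p p')) := by
  refine sylvester_jordan_induction (P := fun p p' =>
    Tendsto (fun ε => A ε p p') l (𝓝 (A₀ p p'))) (fun p p' h1 h2 => ?_) p p'
  rw [sylvester_jordan_apply hA₀ (hd₀ p p')]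
  have hden : Tendsto (fun ε => star (d ε p) - d ε p') l (𝓝 (star (d₀ p) - d₀ p')) :=
    ((hd p).star).sub (hd p')
  have hlim := ((((hB p p').sub ((tendsto_prevEntry h1).const_mul (star (α p.1)))).add
    ((tendsto_prevEntry h2).const_mul (α p'.1))).div hden (sub_ne_zero.2 (hd₀ p p')))
  refine hlim.congr' ?_
  filter_upwards [hA, hden.eventually_ne (sub_ne_zero.2 (hd₀ p p'))] with ε h3 h4
  exact (sylvester_jordan_apply h3 (sub_ne_zero.1 h4)).symm

/-- Continuity of the solution applied to constant data along a one-point filter: the constant `X`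
tends to the solution `0`. -/
theorem jordan_sylvester_inj {α : Fin r → ℂ} {d : Idx m → ℂ} (hd : ∀ p p', star (d p) ≠ d p')
    (X : Matrix (Idx m) (Idx m) ℂ) (hX : (jordan α d)ᴴ * X = X * jordan α d) : X = 0 := by
  ext p p'
  have h := tendsto_sylvester_jordan (l := pure ()) (α := α) (d := fun _ => d) (A := fun _ => X)
    (B := fun _ => 0) (A₀ := 0) hd (fun _ => tendsto_const_nhds) (fun _ _ => tendsto_const_nhds)
    (.of_forall fun _ => sub_eq_zero.2 hX) (by simp) p p'
  exact tendsto_nhds_unique tendsto_const_nhds h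

theorem differentiableAt_sylvester_jordan {α : Fin r → ℂ} {d : Idx m → ℂ}
    {A B : ℝ → Matrix (Idx m) (Idx m) ℂ} {s : ℝ} (hd : ∀ p p', star (d p) ≠ d p')
    (hB : ∀ p p', DifferentiableAt ℝ (fun t => B t p p') s)
    (hA : ∀ t, (jordan α d)ᴴ * A t - A t * jordan α d = B t) (p p' : Idx m) :
    DifferentiableAt ℝ (fun t => A t p p') s := by
  refine sylvester_jordan_induction (P := fun p p' =>
    DifferentiableAt ℝ (fun t => A t p p') s) (fun p p' h1 h2 => ?_) p p'
  simp only [sylvester_jordan_apply (hA _) (hd p p')]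
  have e1 : DifferentiableAt ℝ (fun t => prevEntry (fun p => A t p p') p) s := by
    obtain ⟨i, ⟨_ | k, hk⟩⟩ := p
    · exact differentiableAt_const _
    · exact h1 _ k.lt_succ_self
  have e2 : DifferentiableAt ℝ (fun t => prevEntry (A t p) p') s := by
    obtain ⟨i, ⟨_ | k, hk⟩⟩ := p'
    · exact differentiableAt_const _
    · exact h2 _ k.lt_succ_self
  exact (((hB p p').sub (e1.const_mul _)).add (e2.const_mul _)).div_const _

theorem prevEntry_taylorCoeff {g : Fin r → ℂ → ℂ} (hg : ∀ i, AnalyticAt ℂ (g i) 0) (p : Idx m) :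
    prevEntry (fun p => taylorCoeff (g p.1) p.2) p = taylorCoeff (fun ε => ε * g p.1 ε) p.2 := by
  obtain ⟨i, ⟨_ | k, hk⟩⟩ := p
  · exact (taylorCoeff_id_mul_zero _).symm
  · exact (taylorCoeff_id_mul_succ (hg i) k).symm

theorem genDinv_apply_same (lam α : Fin r → ℂ) (z : ℂ) (i : Fin r) (k l : Fin (m i)) :
    genDinv m lam α z ⟨i, k⟩ ⟨i, l⟩ = if (l : ℕ) ≤ k then
      taylorCoeff (fun μ => 1 / (z - star (lam i) - star (α i) * μ)) ((k : ℕ) - l) else 0 := by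
  rw [genDinv, blockDiagonal'_apply_eq]
  rfl

/-- Inside a block, each entry is one Taylor coefficient of `(z - λ^* - α^* μ) g(μ) = 1`; the cases
say whether its index is positive, zero or negative. -/
theorem gen_resolvent {lam : Fin r → ℂ} (α : Fin r → ℂ) {z : ℂ} (hz : ∀ i, z ≠ star (lam i)) :
    genDinv m lam α z * (z • 1 - (jordan α fun p : Idx m => lam p.1)ᴴ) = 1 := by
  rw [mul_eq_one_comm, Matrix.sub_mul, Matrix.smul_mul, Matrix.one_mul]
  ext p p'
  rw [Matrix.sub_apply, Matrix.smul_apply, jordan_conjTranspose_mul_apply, smul_eq_mul]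
  obtain ⟨i, k⟩ := p
  obtain ⟨j, l⟩ := p'
  by_cases hij : i = j
  · subst hij
    have hne : z - star (lam i) - star (α i) * 0 ≠ 0 := by
      simpa using sub_ne_zero.2 (hz i)
    have han : AnalyticAt ℂ (fun μ => 1 / (z - star (lam i) - star (α i) * μ)) 0 :=
      analyticAt_const.div (by fun_prop) hne
    have hc : ∀ k, taylorCoeff (fun _ : ℂ => (1 : ℂ)) k =
        (z - star (lam i)) * taylorCoeff (fun μ => 1 / (z - star (lam i) - star (α i) * μ)) k -
          star (α i) *
            taylorCoeff (fun ε => ε * (1 / (z - star (lam i) - star (α i) * ε))) k := by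
      intro k
      have h1 := taylorCoeff_affine_mul han (z - star (lam i)) (-star (α i)) k
      rw [neg_mul, ← sub_eq_add_neg] at h1
      rw [← h1]
      refine taylorCoeff_congr ?_ k
      have hcont : ContinuousAt (fun μ : ℂ => z - star (lam i) - star (α i) * μ) 0 := by fun_prop
      filter_upwards [hcont.eventually_ne hne] with μ hμ
      rw [neg_mul, ← sub_eq_add_neg, mul_one_div_cancel hμ]
    generalize hg : (fun μ => 1 / (z - star (lam i) - star (α i) * μ)) = g at *
    have hg' : (fun ε => ε * (1 / (z - star (lam i) - star (α i) * ε))) = fun ε => ε * g ε := by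
      rw [← hg]
    simp only [hg'] at hc
    obtain ⟨l, hl⟩ := l
    obtain ⟨_ | k, hk⟩ := k
    · simp only [genDinv_apply_same, prevEntry, Nat.zero_sub, Nat.le_zero]
      have h0 := hc 0
      rw [taylorCoeff_id_mul_zero, taylorCoeff_zero] at h0
      by_cases hl0 : l = 0
      · subst hl0
        simp only [if_true, hg, one_apply_eq]
        linear_combination -h0
      · simp [hl0, one_apply, Ne.symm hl0]
    · simp only [genDinv_apply_same, prevEntry, hg]
      rcases lt_trichotomy l (k + 1) with h | h | h
      · have h0 := hc (k + 1 - l)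
        obtain ⟨t, ht⟩ : ∃ t, k = l + t := ⟨k - l, by omega⟩
        subst ht
        rw [show l + t + 1 - l = t + 1 by omega, taylorCoeff_const_succ,
          taylorCoeff_id_mul_succ han] at h0
        rw [if_pos h.le, if_pos (by omega), show l + t + 1 - l = t + 1 by omega,
          show l + t - l = t by omega, one_apply_ne (by simp; omega)]
        linear_combination -h0
      · subst h
        have h0 := hc 0
        rw [taylorCoeff_id_mul_zero, taylorCoeff_zero] at h0
        simp only [le_refl, if_true, Nat.sub_self, one_apply_eq, if_neg (Nat.not_succ_le_self k)]
        linear_combination -h0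
      · rw [if_neg (by omega), if_neg (by omega), one_apply_ne (by simp; omega)]
        simp
  · have h0 : ∀ k l, genDinv m lam α z ⟨i, k⟩ ⟨j, l⟩ = 0 := fun k l => by
      rw [genDinv, blockDiagonal'_apply_ne _ _ _ hij]
    have h1 : prevEntry (fun p => genDinv m lam α z p ⟨j, l⟩) ⟨i, k⟩ = 0 := by
      obtain ⟨_ | k, hk⟩ := k
      · rfl
      · exact h0 _ _
    rw [h0, h1, one_apply_ne (by simp [hij])]
    simp

end Jordan

/-! ### Taylor coefficients of a holomorphic family of Lax solutions -/

section LaxFamily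

open Metric

variable {a σ : ℝ} {ρ : ℤ → ℝ → ℝ} {q : ℤ → ℝ → ℂ} {lam α : ℂ} {W : Set ℂ}
  {y : ℂ → ℤ → ℝ → Fin 2 → ℂ}

theorem exists_radius (hW : IsOpen W) (hlam : lam ∈ W) (α : ℂ) :
    ∃ R > 0, ∀ ε ∈ closedBall (0 : ℂ) R, lam + α * ε ∈ W := by
  have hc : ContinuousAt (fun ε : ℂ => lam + α * ε) 0 := by fun_prop
  have h : ∀ᶠ ε in 𝓝 (0 : ℂ), lam + α * ε ∈ W :=
    hc.eventually_mem (hW.mem_nhds (by simpa using hlam))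
  obtain ⟨R, hR, hRW⟩ := Metric.nhds_basis_closedBall.eventually_iff.1 h
  exact ⟨R, hR, fun ε hε => hRW hε⟩

theorem differentiableOn_family {R : ℝ} (hR : ∀ ε ∈ closedBall (0 : ℂ) R, lam + α * ε ∈ W)
    (hhol : ∀ n s, DifferentiableOn ℂ (fun z => y z n s) W) (n : ℤ) (s : ℝ) :
    DifferentiableOn ℂ (fun ε => y (lam + α * ε) n s) (closedBall 0 R) :=
  (hhol n s).comp (f := fun ε : ℂ => lam + α * ε) (by fun_prop) hR

theorem analyticAt_family (hW : IsOpen W) (hlam : lam ∈ W)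
    (hhol : ∀ n s, DifferentiableOn ℂ (fun z => y z n s) W) (n : ℤ) (s : ℝ) (x : Fin 2) :
    AnalyticAt ℂ (fun ε => y (lam + α * ε) n s x) 0 := by
  obtain ⟨R, hR, hRW⟩ := exists_radius hW hlam α
  exact (differentiableOn_pi.1 (differentiableOn_family hRW hhol n s) x).analyticAt
    (closedBall_mem_nhds 0 hR)

theorem taylorCoeff_shift (hW : IsOpen W) (hlam : lam ∈ W) (h0 : lam ≠ 0)
    (hhol : ∀ n s, DifferentiableOn ℂ (fun z => y z n s) W)
    (hy : ∀ z ∈ W, IsLaxSolution a σ ρ q z (y z)) (n : ℤ) (s : ℝ) (x : Fin 2) (k : ℕ) :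
    lam * taylorCoeff (fun ε => y (lam + α * ε) (n + 1) s x) k +
        α * taylorCoeff (fun ε => ε * y (lam + α * ε) (n + 1) s x) k =
      lam * taylorCoeff (fun ε => y (lam + α * ε) n s x) k +
        α * taylorCoeff (fun ε => ε * y (lam + α * ε) n s x) k +
        (laxA a σ ρ q n s x 0 * taylorCoeff (fun ε => y (lam + α * ε) n s 0) k +
          laxA a σ ρ q n s x 1 * taylorCoeff (fun ε => y (lam + α * ε) n s 1) k) := by
  have han := analyticAt_family (α := α) hW hlam hhol
  rw [← taylorCoeff_affine_mul (han _ _ _), ← taylorCoeff_affine_mul (han _ _ _),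
    ← taylorCoeff_linear (han _ _ _) (han _ _ _),
    ← taylorCoeff_add (f := fun ε => (lam + α * ε) * y (lam + α * ε) n s x)
      (g := fun ε => laxA a σ ρ q n s x 0 * y (lam + α * ε) n s 0 +
        laxA a σ ρ q n s x 1 * y (lam + α * ε) n s 1) (AnalyticAt.mul (by fun_prop) (han _ _ _))
      ((analyticAt_const.mul (han _ _ _)).add (analyticAt_const.mul (han _ _ _)))]
  refine taylorCoeff_congr ?_ k
  have hc : ContinuousAt (fun ε : ℂ => lam + α * ε) 0 := by fun_prop
  filter_upwards [hc.eventually_mem (hW.mem_nhds (by simpa using hlam)),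
    hc.eventually_ne (by simpa using h0)] with ε hε hε0
  rw [(hy _ hε).1]
  exact laxU_mulVec_apply hε0 a σ ρ q n s _ x

theorem norm_laxV_mulVec_le (σ : ℝ) (q : ℤ → ℝ → ℂ) (z : ℂ) (n : ℤ) (s : ℝ) (v : Fin 2 → ℂ) :
    ‖laxV σ q z n s *ᵥ v‖ ≤ (‖z‖ / 4 + (1 + |σ|) * ‖q n s‖ / 2) * ‖v‖ := by
  have h0 := norm_le_pi_norm v 0
  have h1 := norm_le_pi_norm v 1
  refine (pi_norm_le_iff_of_nonneg (by positivity)).2 fun x => ?_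
  rw [laxV_mulVec_apply]
  refine (norm_add_le _ _).trans ?_
  have hq := norm_nonneg (q n s)
  have hv := norm_nonneg v
  fin_cases x
  · simp only [sigma3, potQ, Fin.zero_eta, of_apply, cons_val', cons_val_zero, cons_val_one,
      cons_val_fin_one, one_mul, zero_mul, add_zero, zero_add, norm_mul, norm_div,
      Complex.norm_I, norm_star, Complex.norm_real, Real.norm_eq_abs, Complex.norm_ofNat]
    have e1 : ‖z‖ * ‖v 0‖ ≤ ‖z‖ * ‖v‖ := by gcongr
    have e2 : |σ| * ‖q n s‖ * ‖v 1‖ ≤ |σ| * ‖q n s‖ * ‖v‖ := by gcongr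
    nlinarith [mul_nonneg hq hv]
  · simp only [sigma3, potQ, Fin.mk_one, of_apply, cons_val', cons_val_zero, cons_val_one,
      cons_val_fin_one, neg_mul, one_mul, zero_mul, add_zero, zero_add, norm_mul, norm_div,
      norm_neg, mul_neg, Complex.norm_I, Complex.norm_ofNat]
    have e1 : ‖z‖ * ‖v 1‖ ≤ ‖z‖ * ‖v‖ := by gcongr
    have e2 : ‖q n s‖ * ‖v 0‖ ≤ ‖q n s‖ * ‖v‖ := by gcongr
    nlinarith [mul_nonneg (mul_nonneg (abs_nonneg σ) hq) hv]

/-- Joint continuity in the spectral parameter and `s` is not assumed. Compactness of the circle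
bounds the family at the single time `s - 1`, and Gronwall's inequality carries the bound over `[s -
1, s + 1]`, whence the factor `exp (2 K)`. -/
theorem hasDerivAt_taylorCoeff_family (hq : ∀ n, Differentiable ℝ (q n)) (hW : IsOpen W)
    (hlam : lam ∈ W) (hhol : ∀ n s, DifferentiableOn ℂ (fun z => y z n s) W)
    (hy : ∀ z ∈ W, IsLaxSolution a σ ρ q z (y z)) (n : ℤ) (s : ℝ) (x : Fin 2) (k : ℕ) :
    HasDerivAt (fun t => taylorCoeff (fun ε => y (lam + α * ε) n t x) k)
      (taylorCoeff (fun ε => (laxV σ q (lam + α * ε) n s *ᵥ y (lam + α * ε) n s) x) k) s := by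
  obtain ⟨R, hR, hRW⟩ := exists_radius hW hlam α
  have hol := differentiableOn_family hRW hhol
  obtain ⟨C₀, hC₀⟩ := (isCompact_sphere (0 : ℂ) R).exists_bound_of_continuousOn
    ((hol n (s - 1)).continuousOn.mono sphere_subset_closedBall)
  obtain ⟨Cq, hCq⟩ := (isCompact_Icc (a := s - 1) (b := s + 1)).exists_bound_of_continuousOn
    (hq n).continuous.continuousOn
  set K := (‖lam‖ + ‖α‖ * R) / 4 + (1 + |σ|) * Cq / 2 with hK
  have hCq0 : 0 ≤ Cq := (norm_nonneg _).trans (hCq s ⟨by linarith, by linarith⟩)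
  have hK0 : 0 ≤ K := by positivity
  have hbd : ∀ w ∈ sphere (0 : ℂ) R, ∀ t ∈ Set.Icc (s - 1) (s + 1), ∀ v : Fin 2 → ℂ,
      ‖laxV σ q (lam + α * w) n t *ᵥ v‖ ≤ K * ‖v‖ := by
    intro w hw t ht v
    refine (norm_laxV_mulVec_le _ _ _ _ _ _).trans ?_
    have h1 : ‖lam + α * w‖ ≤ ‖lam‖ + ‖α‖ * R := by
      refine (norm_add_le _ _).trans ?_
      rw [norm_mul, mem_sphere_zero_iff_norm.1 hw]
    rw [hK]
    gcongr
    exact hCq t ht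
  have hyb : ∀ w ∈ sphere (0 : ℂ) R, ∀ t ∈ Set.Icc (s - 1) (s + 1),
      ‖y (lam + α * w) n t‖ ≤ C₀ * Real.exp (K * 2) := by
    intro w hw t ht
    have hsol := (hy _ (hRW w (sphere_subset_closedBall hw))).2 n
    have h1 := norm_le_gronwallBound_of_norm_deriv_right_le (f := y (lam + α * w) n)
      (f' := fun t => laxV σ q (lam + α * w) n t *ᵥ y (lam + α * w) n t) (δ := C₀) (K := K)
      (ε := 0) (a := s - 1) (b := s + 1)
      (fun t _ => (hsol t).continuousAt.continuousWithinAt)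
      (fun t _ => (hsol t).hasDerivWithinAt) (hC₀ w hw)
      (fun t ht => by simpa using hbd w hw t ⟨ht.1, ht.2.le⟩ _) t ht
    rw [gronwallBound_ε0] at h1
    refine h1.trans ?_
    have h2 : 0 ≤ C₀ := (norm_nonneg _).trans (hC₀ w hw)
    gcongr
    linarith [ht.2]
  have hcomp := fun t => differentiableOn_pi.1 (hol n t)
  refine hasDerivAt_taylorCoeff
    (F := fun ε t => y (lam + α * ε) n t x)
    (F' := fun ε t => (laxV σ q (lam + α * ε) n t *ᵥ y (lam + α * ε) n t) x)
    (C := K * (C₀ * Real.exp (K * 2))) hR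
    (Icc_mem_nhds (a := s - 1) (b := s + 1) (by linarith) (by linarith))
    (fun t => hcomp t x) ?_ (fun w hw t => hasDerivAt_pi.1 ((hy _ (hRW w hw)).2 n t) x) ?_ k
  · simp only [laxV_mulVec_apply]
    have h0 := hcomp s 0
    have h1 := hcomp s 1
    have haff : DifferentiableOn ℂ (fun ε : ℂ => lam + α * ε) (closedBall 0 R) := by fun_prop
    exact ((haff.mul ((h0.const_mul _).add (h1.const_mul _))).const_mul _).add
      (((h0.const_mul _).add (h1.const_mul _)).const_mul _)
  · intro w hw t ht
    refine (norm_le_pi_norm _ x).trans ((hbd w hw t ht _).trans ?_)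
    gcongr
    exact hyb w hw t ht

theorem taylorCoeff_laxV (hW : IsOpen W)
    (hlam : lam ∈ W) (hhol : ∀ n s, DifferentiableOn ℂ (fun z => y z n s) W)
    (n : ℤ) (s : ℝ) (x : Fin 2) (k : ℕ) :
    taylorCoeff (fun ε => (laxV σ q (lam + α * ε) n s *ᵥ y (lam + α * ε) n s) x) k =
      Complex.I / 4 * (sigma3 x 0 * (lam * taylorCoeff (fun ε => y (lam + α * ε) n s 0) k +
          α * taylorCoeff (fun ε => ε * y (lam + α * ε) n s 0) k) +
        sigma3 x 1 * (lam * taylorCoeff (fun ε => y (lam + α * ε) n s 1) k +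
          α * taylorCoeff (fun ε => ε * y (lam + α * ε) n s 1) k)) +
      Complex.I / 2 * (potQ σ (q n s) x 0 * taylorCoeff (fun ε => y (lam + α * ε) n s 0) k +
        potQ σ (q n s) x 1 * taylorCoeff (fun ε => y (lam + α * ε) n s 1) k) := by
  have han := analyticAt_family (α := α) hW hlam hhol n s
  have han' : ∀ x, AnalyticAt ℂ (fun ε => (lam + α * ε) * y (lam + α * ε) n s x) 0 :=
    fun x => AnalyticAt.mul (by fun_prop) (han x)
  have hlin := fun c d => (analyticAt_const (v := c)).mul (han' 0) |>.add
    ((analyticAt_const (v := d)).mul (han' 1))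
  have hlin' := fun c d => (analyticAt_const (v := c)).mul (han 0) |>.add
    ((analyticAt_const (v := d)).mul (han 1))
  rw [← taylorCoeff_affine_mul (han 0), ← taylorCoeff_affine_mul (han 1),
    ← taylorCoeff_linear (han' 0) (han' 1), ← taylorCoeff_linear (han 0) (han 1),
    ← taylorCoeff_linear
      (f := fun ε => sigma3 x 0 * ((lam + α * ε) * y (lam + α * ε) n s 0) +
        sigma3 x 1 * ((lam + α * ε) * y (lam + α * ε) n s 1))
      (g := fun ε => potQ σ (q n s) x 0 * y (lam + α * ε) n s 0 +
        potQ σ (q n s) x 1 * y (lam + α * ε) n s 1) (hlin _ _) (hlin' _ _)]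
  refine congrArg (taylorCoeff · k) (funext fun ε => ?_)
  rw [laxV_mulVec_apply]
  ring

end LaxFamily

/-! ### Coefficients of the kernel in two independent variables -/

section KernelCoeff

/-- The Taylor coefficients of `(Σₓ Jₓ uₓ(μ) vₓ(ε)) / (c + β μ - α ε)` satisfy the recursion that
clears the denominator. -/
theorem taylorCoeff_kernel {c α β τ : ℂ} (hc : c ≠ 0) {u v : Fin 2 → ℂ → ℂ}
    (hu : ∀ x, AnalyticAt ℂ (u x) 0) (hv : ∀ x, AnalyticAt ℂ (v x) 0) {K : ℂ → ℂ → ℂ}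
    (hK : ∀ μ ε, K μ ε = (u 0 μ * v 0 ε + τ * (u 1 μ * v 1 ε)) / (c + β * μ - α * ε)) :
    (∀ᶠ μ in 𝓝 0, AnalyticAt ℂ (K μ) 0) ∧
    (∀ l, AnalyticAt ℂ (fun μ => taylorCoeff (K μ) l) 0) ∧
    ∀ k l, c * taylorCoeff (fun μ => taylorCoeff (K μ) l) k +
      β * taylorCoeff (fun μ => μ * taylorCoeff (K μ) l) k -
      α * taylorCoeff (fun μ => taylorCoeff (fun ε => ε * K μ ε) l) k =
        taylorCoeff (u 0) k * taylorCoeff (v 0) l +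
          τ * (taylorCoeff (u 1) k * taylorCoeff (v 1) l) := by
  have hden : ∀ᶠ μ in 𝓝 (0 : ℂ), c + β * μ ≠ 0 := by
    have hcont : ContinuousAt (fun μ : ℂ => c + β * μ) 0 := by fun_prop
    exact hcont.eventually_ne (by simpa using hc)
  have hKan : ∀ μ, c + β * μ ≠ 0 → AnalyticAt ℂ (K μ) 0 := by
    intro μ hμ
    have e : K μ = fun ε => (u 0 μ * v 0 ε + τ * (u 1 μ * v 1 ε)) / (c + β * μ - α * ε) :=
      funext fun ε => hK μ ε
    rw [e]
    exact ((analyticAt_const.mul (hv 0)).add (analyticAt_const.mul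
      (analyticAt_const.mul (hv 1)))).div (by fun_prop) (by simpa using hμ)
  have hrec : ∀ l, ∀ μ, c + β * μ ≠ 0 → (c + β * μ) * taylorCoeff (K μ) l -
      α * taylorCoeff (fun ε => ε * K μ ε) l =
        u 0 μ * taylorCoeff (v 0) l + τ * (u 1 μ * taylorCoeff (v 1) l) := by
    intro l μ hμ
    have h1 := taylorCoeff_affine_mul (hKan μ hμ) (c + β * μ) (-α) l
    rw [neg_mul, ← sub_eq_add_neg] at h1
    rw [← h1, ← mul_assoc τ, ← taylorCoeff_linear (hv 0) (hv 1)]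
    refine taylorCoeff_congr ?_ l
    have hcont : ContinuousAt (fun ε : ℂ => c + β * μ - α * ε) 0 := by fun_prop
    filter_upwards [hcont.eventually_ne (by simpa using hμ)] with ε hε
    rw [hK, neg_mul, ← sub_eq_add_neg, mul_div_cancel₀ _ hε, mul_assoc]
  have hprev : ∀ l, AnalyticAt ℂ (fun μ => taylorCoeff (fun ε => ε * K μ ε) l) 0 →
      AnalyticAt ℂ (fun μ => taylorCoeff (K μ) l) 0 := by
    intro l h1
    have h2 : AnalyticAt ℂ (fun μ => (u 0 μ * taylorCoeff (v 0) l +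
        τ * (u 1 μ * taylorCoeff (v 1) l) + α * taylorCoeff (fun ε => ε * K μ ε) l) /
          (c + β * μ)) 0 :=
      ((((hu 0).mul analyticAt_const).add (analyticAt_const.mul
        ((hu 1).mul analyticAt_const))).add (analyticAt_const.mul h1)).div (by fun_prop)
        (by simpa using hc)
    refine h2.congr ?_
    filter_upwards [hden] with μ hμ
    rw [div_eq_iff hμ, ← hrec l μ hμ]
    ring
  -- Induction on `l`: the recursion expresses the `l`-th coefficient through the previous one with
  -- denominator `c + β μ`, so analyticity in `μ` propagates.
  have hboth : ∀ l, AnalyticAt ℂ (fun μ => taylorCoeff (fun ε => ε * K μ ε) l) 0 := by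
    intro l
    induction l with
    | zero =>
      simp only [taylorCoeff_id_mul_zero]
      exact analyticAt_const
    | succ l ih =>
      refine (hprev l ih).congr ?_
      filter_upwards [hden] with μ hμ
      exact (taylorCoeff_id_mul_succ (hKan μ hμ) l).symm
  refine ⟨hden.mono hKan, fun l => hprev l (hboth l), fun k l => ?_⟩
  have hl := hprev l (hboth l)
  have h1 := taylorCoeff_affine_mul hl c β k
  rw [← h1, sub_eq_add_neg, ← neg_mul, ← taylorCoeff_const_mul,
    ← taylorCoeff_add (f := fun μ => (c + β * μ) * taylorCoeff (K μ) l)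
      (g := fun μ => -α * taylorCoeff (fun ε => ε * K μ ε) l)
      (AnalyticAt.mul (by fun_prop) hl) (analyticAt_const.mul (hboth l)),
    mul_comm (taylorCoeff (u 0) k), mul_comm (taylorCoeff (u 1) k), ← mul_assoc τ,
    ← taylorCoeff_linear (hu 0) (hu 1)]
  refine taylorCoeff_congr ?_ k
  filter_upwards [hden] with μ hμ
  have h2 := hrec l μ hμ
  linear_combination h2

end KernelCoeff

/-! ### The generalized case: bidiagonal `Λ` -/

section GeneralizedDressing

variable {a σ : ℝ} {ρ : ℤ → ℝ → ℝ} {q : ℤ → ℝ → ℂ} {r : ℕ} {m : Fin r → ℕ} {lam : Fin r → ℂ}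
  {α : Fin r → ℂ} {W : Fin r → Set ℂ} {y : Fin r → ℂ → ℤ → ℝ → Fin 2 → ℂ}

/-- Clear the denominator of the kernel and compare coefficients: the factors `μ` and `ε` shift rows
and columns, which is the action of `Λ†` on the left and of `Λ` on the right. -/
theorem gen_sylvester (σ : ℝ) (m : Fin r → ℕ) (α : Fin r → ℂ)
    (hlam : ∀ i j, star (lam i) ≠ lam j) (hW : ∀ i, IsOpen (W i) ∧ lam i ∈ W i)
    (hhol : ∀ i n s, DifferentiableOn ℂ (fun z => y i z n s) (W i)) (n : ℤ) (s : ℝ) :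
    (jordan α fun p : Idx m => lam p.1)ᴴ * genM σ m lam α y n s -
        genM σ m lam α y n s * (jordan α fun p : Idx m => lam p.1) =
      (genY m lam α y n s)ᴴ * J σ * genY m lam α y n s := by
  have han : ∀ i x, AnalyticAt ℂ (fun ε => y i (lam i + α i * ε) n s x) 0 := fun i x =>
    analyticAt_family (hW i).1 (hW i).2 (hhol i) n s x
  ext p p'
  rw [Matrix.sub_apply, jordan_conjTranspose_mul_apply, mul_jordan_apply,
    conjTranspose_mul_J_mul_apply, bracket_eq]
  obtain ⟨h1, h2, h3⟩ := taylorCoeff_kernel (α := α p'.1) (β := star (α p.1)) (τ := σ)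
    (sub_ne_zero.2 (hlam p.1 p'.1))
    (u := fun x μ => star (y p.1 (lam p.1 + α p.1 * star μ) n s x))
    (v := fun x ε => y p'.1 (lam p'.1 + α p'.1 * ε) n s x)
    (fun x => analyticAt_star_star (han p.1 x)) (han p'.1)
    (K := fun μ ε => kernelM σ lam α y n s p.1 p'.1 μ ε)
    (fun μ ε => by rw [kernelM, bracket_eq])
  have h4 := h3 p.2 p'.2
  rw [taylorCoeff_star_star (fun ε => y p.1 (lam p.1 + α p.1 * ε) n s 0),
    taylorCoeff_star_star (fun ε => y p.1 (lam p.1 + α p.1 * ε) n s 1)] at h4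
  have hrow : prevEntry (fun p => genM σ m lam α y n s p p') p = taylorCoeff (fun μ => μ *
      taylorCoeff (fun ε => kernelM σ lam α y n s p.1 p'.1 μ ε) p'.2) p.2 := by
    obtain ⟨i, ⟨_ | k, hk⟩⟩ := p
    · exact (taylorCoeff_id_mul_zero _).symm
    · exact (taylorCoeff_id_mul_succ (h2 p'.2) k).symm
  have hcol : prevEntry (genM σ m lam α y n s p) p' = taylorCoeff (fun μ =>
      taylorCoeff (fun ε => ε * kernelM σ lam α y n s p.1 p'.1 μ ε) p'.2) p.2 := by
    obtain ⟨j, ⟨_ | l, hl⟩⟩ := p'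
    · simp only [prevEntry, taylorCoeff_id_mul_zero]
      obtain ⟨i, ⟨_ | k, hk⟩⟩ := p
      · exact (taylorCoeff_zero fun _ => 0).symm
      · exact (taylorCoeff_const_succ 0 k).symm
    · refine taylorCoeff_congr ?_ _
      filter_upwards [h1] with μ hμ
      exact (taylorCoeff_id_mul_succ hμ l).symm
  rw [hrow, hcol]
  simp only [genM, genY, of_apply]
  linear_combination h4

theorem gen_isDressing (α : Fin r → ℂ) (m : Fin r → ℕ) (hq : ∀ n, Differentiable ℝ (q n))
    (hlam : ∀ i j, star (lam i) ≠ lam j)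
    (hW : ∀ i, IsOpen (W i) ∧ lam i ∈ W i)
    (hhol : ∀ i n s, DifferentiableOn ℂ (fun z => y i z n s) (W i))
    (hy : ∀ i, ∀ z ∈ W i, IsLaxSolution a σ ρ q z (y i z)) :
    IsDressing a σ ρ q (jordan α fun p : Idx m => lam p.1) (fun n s => genY m lam α y n s)
      (fun n s => genM σ m lam α y n s) := by
  have hlam0 : ∀ i, lam i ≠ 0 := fun i h => hlam i i (by simp [h])
  have hprev : ∀ n s x p, prevEntry (genY m lam α y n s x) p =
      taylorCoeff (fun ε => ε * y p.1 (lam p.1 + α p.1 * ε) n s x) p.2 := fun n s x p =>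
    prevEntry_taylorCoeff (g := fun i ε => y i (lam i + α i * ε) n s x)
      (fun i => analyticAt_family (hW i).1 (hW i).2 (hhol i) n s x) p
  have hderiv : ∀ n s, HasMatDerivAt (fun t => genY m lam α y n t)
      ((Complex.I / 4) • (sigma3 * genY m lam α y n s * (jordan α fun p : Idx m => lam p.1)) +
        (Complex.I / 2) • (potQ σ (q n s) * genY m lam α y n s)) s := by
    intro n s x p
    refine (hasDerivAt_taylorCoeff_family hq (hW p.1).1 (hW p.1).2 (hhol p.1) (hy p.1) n s x
      p.2).congr_deriv ?_
    rw [taylorCoeff_laxV (hW p.1).1 (hW p.1).2 (hhol p.1), Matrix.mul_assoc]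
    simp only [Matrix.add_apply, Matrix.smul_apply, Matrix.mul_apply (M := sigma3),
      Matrix.mul_apply (M := potQ σ (q n s)), Fin.sum_univ_two, mul_jordan_apply, hprev,
      smul_eq_mul]
    simp only [genY, of_apply]
    ring
  refine ⟨jordan_sylvester_inj fun p p' => hlam p.1 p'.1, gen_sylvester σ m α hlam hW hhol,
    fun n s => ?_, hderiv, fun n s => ?_⟩
  · ext x p
    have h := taylorCoeff_shift (α := α p.1) (hW p.1).1 (hW p.1).2 (hlam0 p.1) (hhol p.1) (hy p.1)
      n s x p.2
    rw [mul_jordan_apply, Matrix.add_apply, mul_jordan_apply, Matrix.mul_apply, Fin.sum_univ_two,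
      hprev, hprev]
    simp only [genY, of_apply]
    linear_combination h
  -- Differentiability of `M` comes from that of `Y† J Y` through the entrywise recursion, without
  -- differentiating the kernel.
  · have hM := differentiableAt_sylvester_jordan (s := s) (fun p p' => hlam p.1 p'.1)
      (fun p p' => (((hderiv n s).conjTranspose.mul_const (J σ)).mul (hderiv n s)
        p p').differentiableAt) (gen_sylvester σ m α hlam hW hhol n)
    exact ⟨of fun p p' => deriv (fun t => genM σ m lam α y n t p p') s,
      fun p p' => (hM p p').hasDerivAt⟩

end GeneralizedDressing

/-! ### Newton basis and diagonalization of the split Jordan matrix -/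

section NewtonBasis

variable {r : ℕ} {m : Fin r → ℕ}

/-- The points of the `i`-th group as a sequence, continued by zeros. -/
def nodes (ε : Idx m → ℂ) (i : Fin r) (l : ℕ) : ℂ :=
  if h : l < m i then ε ⟨i, ⟨l, h⟩⟩ else 0

theorem nodes_val (ε : Idx m → ℂ) (p : Idx m) : nodes ε p.1 p.2 = ε p := by
  rw [nodes, dif_pos p.2.2]

/-- The values of the Newton basis polynomials at the nodes. -/
def newtonMatrix (ε : Idx m → ℂ) : Matrix (Idx m) (Idx m) ℂ :=
  of fun p p' => if p.1 = p'.1 then ∏ l ∈ Finset.range p.2, (ε p' - nodes ε p.1 l) else 0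

theorem prevEntry_single {i : Fin r} {k : ℕ} (hk : k + 1 < m i) (p : Idx m) :
    prevEntry (fun p' => if (⟨i, ⟨k, Nat.lt_of_succ_lt hk⟩⟩ : Idx m) = p' then (1 : ℂ) else 0) p =
      if p = ⟨i, ⟨k + 1, hk⟩⟩ then 1 else 0 := by
  obtain ⟨j, ⟨_ | l, hl⟩⟩ := p <;> by_cases h : i = j
  · subst h
    simp [prevEntry]
  · simp [prevEntry, Ne.symm h]
  · subst h
    simp [prevEntry, eq_comm]
  · simp [prevEntry, h, Ne.symm h]

theorem prevEntry_single_last {i : Fin r} {k : ℕ} {hk : k < m i} (hk1 : ¬ k + 1 < m i)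
    (p : Idx m) :
    prevEntry (fun p' => if (⟨i, ⟨k, hk⟩⟩ : Idx m) = p' then (1 : ℂ) else 0) p = 0 := by
  obtain ⟨j, ⟨_ | l, hl⟩⟩ := p
  · rfl
  · refine if_neg fun h => ?_
    obtain ⟨h1, h2⟩ := Sigma.mk.inj_iff.1 h
    subst h1
    have h3 := congrArg Fin.val (eq_of_heq h2)
    simp only at h3
    omega

/-- With `P_k` the Newton polynomials of a group, `x P_k = ε_k P_k + P_{k+1}`: multiplication by `x`
is bidiagonal in this basis and diagonal on values at the nodes. -/
theorem jordan_mul_newtonMatrix (α : Fin r → ℂ) (lam : Fin r → ℂ) (ε : Idx m → ℂ) :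
    jordan α (splitLam m lam α ε) * newtonMatrix ε =
      newtonMatrix ε * diagonal (splitLam m lam α ε) := by
  ext p p'
  rw [mul_diagonal, jordan, Matrix.add_mul, Matrix.add_apply, diagonal_mul]
  have hsum : ((of fun p p' : Idx m => α p'.1 * prevEntry (fun p'' => if p = p'' then 1 else 0) p')
      * newtonMatrix ε) p p' =
      if p.1 = p'.1 then α p.1 * ∏ l ∈ Finset.range (p.2 + 1), (ε p' - nodes ε p.1 l) else 0 := by
    obtain ⟨i, k, hk⟩ := p
    rw [Matrix.mul_apply]
    by_cases hk1 : k + 1 < m i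
    · simp only [of_apply, prevEntry_single hk1, mul_ite, mul_one, mul_zero, ite_mul, zero_mul,
        Finset.sum_ite_eq', Finset.mem_univ, if_true]
      simp only [newtonMatrix, of_apply, mul_ite, mul_zero]
    · simp only [of_apply, prevEntry_single_last hk1, mul_zero, zero_mul, Finset.sum_const_zero]
      obtain ⟨j, k', hk'⟩ := p'
      split_ifs with h
      · simp only at h
        subst h
        -- In the last row the next Newton polynomial is missing from the matrix, but it vanishes at
        -- every node of the group.
        rw [Finset.prod_eq_zero (Finset.mem_range.2 (show k' < k + 1 by omega)), mul_zero]
        rw [nodes, dif_pos hk', sub_self]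
      · rfl
  rw [hsum]
  by_cases h : p.1 = p'.1
  · simp only [newtonMatrix, of_apply, if_pos h, Finset.prod_range_succ, nodes_val]
    simp only [splitLam, ← h]
    ring
  · simp [newtonMatrix, h]

/-- Each block is upper triangular with diagonal entries `∏_{l < k} (ε_k - ε_l)`, nonzero for
distinct nodes. -/
theorem isUnit_det_newtonMatrix {ε : Idx m → ℂ}
    (hε : ∀ i, Function.Injective fun k : Fin (m i) => ε ⟨i, k⟩) :
    IsUnit (newtonMatrix ε).det := by
  let B : ∀ i : Fin r, Matrix (Fin (m i)) (Fin (m i)) ℂ := fun i =>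
    of fun k k' => ∏ l ∈ Finset.range k, (ε ⟨i, k'⟩ - nodes ε i l)
  have hB : ∀ i, IsUnit (B i).det := by
    intro i
    rw [isUnit_iff_ne_zero, det_of_isUpperTriangular, Finset.prod_ne_zero_iff]
    · intro k _
      change ∏ l ∈ Finset.range (k : ℕ), (ε ⟨i, k⟩ - nodes ε i l) ≠ 0
      refine Finset.prod_ne_zero_iff.2 fun l hl => ?_
      have hlk : l < k := by simpa using hl
      rw [nodes, dif_pos (hlk.trans k.2), sub_ne_zero]
      exact fun h => (ne_of_gt hlk) (congrArg Fin.val (hε i h))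
    · intro k k' hk
      refine Finset.prod_eq_zero (Finset.mem_range.2 (show (k' : ℕ) < k from hk)) ?_
      exact sub_eq_zero.2 (nodes_val ε ⟨i, k'⟩).symm
  have h1 : newtonMatrix ε = blockDiagonal' B := by
    ext ⟨i, k⟩ ⟨j, l⟩
    by_cases h : i = j
    · subst h
      simp [newtonMatrix, B, blockDiagonal'_apply_eq]
    · rw [blockDiagonal'_apply_ne _ _ _ h]
      simp [newtonMatrix, h]
  have h2 : newtonMatrix ε * blockDiagonal' (fun i => (B i)⁻¹) = 1 := by
    rw [h1, ← blockDiagonal'_mul]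
    simp only [mul_nonsing_inv _ (hB _)]
    exact blockDiagonal'_one
  exact (isUnit_iff_isUnit_det _).1 (.of_mul_eq_one _ h2)

end NewtonBasis

/-! ### Invariance of the Darboux matrix under change of basis -/

section CongruenceInvariance

variable {ι : Type*} [Fintype ι] [DecidableEq ι] {B Λ D M : Matrix ι ι ℂ}

theorem sylvester_congr {Y : Matrix (Fin 2) ι ℂ} {S : Matrix (Fin 2) (Fin 2) ℂ}
    (hB : IsUnit B.det) (hΛ : Λ * B = B * D)
    (hS : Dᴴ * M - M * D = (Y * B)ᴴ * S * (Y * B)) :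
    Λᴴ * ((Bᴴ)⁻¹ * M * B⁻¹) - (Bᴴ)⁻¹ * M * B⁻¹ * Λ = Yᴴ * S * Y := by
  have hBH : IsUnit (Bᴴ).det := by rw [det_conjTranspose]; exact hB.star
  have h1 : B⁻¹ * Λ = D * B⁻¹ := by
    have h := congrArg (fun X => B⁻¹ * X * B⁻¹) hΛ
    simpa only [Matrix.mul_assoc, mul_nonsing_inv _ hB, Matrix.mul_one,
      nonsing_inv_mul_cancel_left _ _ hB] using h
  have h2 : Λᴴ * (Bᴴ)⁻¹ = (Bᴴ)⁻¹ * Dᴴ := by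
    have h := congrArg conjTranspose h1
    simpa only [conjTranspose_mul, conjTranspose_nonsing_inv] using h
  have h3 := congrArg (fun X => (Bᴴ)⁻¹ * X * B⁻¹) hS
  simp only [conjTranspose_mul, Matrix.mul_assoc, mul_nonsing_inv _ hB, Matrix.mul_one,
    nonsing_inv_mul_cancel_left _ _ hBH] at h3
  rw [← Matrix.mul_assoc Λᴴ, ← Matrix.mul_assoc Λᴴ, h2, Matrix.mul_assoc _ B⁻¹, h1,
    Matrix.mul_assoc Yᴴ, ← h3]
  simp only [Matrix.sub_mul, Matrix.mul_sub, Matrix.mul_assoc]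

/-- Passing from `(D, Y B, M)` to `(Λ, Y, B⁻† M B⁻¹)` changes only the basis of the columns, and all
factors `B` cancel. -/
theorem dressing_congr {Y : Matrix (Fin 2) ι ℂ} (z : ℂ)
    (hB : IsUnit B.det) (hΛ : Λ * B = B * D) :
    Y * B * M⁻¹ * (z • 1 - Dᴴ)⁻¹ * (Y * B)ᴴ =
      Y * ((Bᴴ)⁻¹ * M * B⁻¹)⁻¹ * (z • 1 - Λᴴ)⁻¹ * Yᴴ := by
  have hBH : IsUnit (Bᴴ).det := by rw [det_conjTranspose]; exact hB.star
  have h1 : (z • 1 - Λᴴ) = (Bᴴ)⁻¹ * (z • 1 - Dᴴ) * Bᴴ := by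
    have h := congrArg conjTranspose hΛ
    rw [conjTranspose_mul, conjTranspose_mul] at h
    rw [Matrix.mul_sub, Matrix.sub_mul, Matrix.mul_assoc _ Dᴴ, ← h,
      nonsing_inv_mul_cancel_left _ _ hBH, Matrix.mul_smul, Matrix.mul_one, Matrix.smul_mul,
      nonsing_inv_mul _ hBH]
  rw [h1]
  simp only [Matrix.mul_inv_rev, nonsing_inv_nonsing_inv _ hB, nonsing_inv_nonsing_inv _ hBH,
    conjTranspose_mul, Matrix.mul_assoc, mul_nonsing_inv_cancel_left _ _ hBH]

end CongruenceInvariance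

/-! ### Coalescence of the spectral points -/

section CoalescenceLimit

open Metric

variable {r : ℕ} {m : Fin r → ℕ} {lam : Fin r → ℂ} {α : Fin r → ℂ} {W : Fin r → Set ℂ}
  {y : Fin r → ℂ → ℤ → ℝ → Fin 2 → ℂ}

/-- The matrix of divided differences of the eigenvectors at the split spectral points. -/
def dividedDiffY (m : Fin r → ℕ) (R : Fin r → ℝ) (lam α : Fin r → ℂ)
    (y : Fin r → ℂ → ℤ → ℝ → Fin 2 → ℂ) (n : ℤ) (s : ℝ) (ε : Idx m → ℂ) :
    Matrix (Fin 2) (Idx m) ℂ :=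
  of fun x p =>
    dividedDiff (R p.1) (fun w => y p.1 (lam p.1 + α p.1 * w) n s x) (nodes ε p.1) p.2

theorem dividedDiffY_mul_newtonMatrix {R : Fin r → ℝ} {n : ℤ} {s : ℝ} (hR : ∀ i, 0 < R i)
    (hhol : ∀ i x, DifferentiableOn ℂ (fun ε => y i (lam i + α i * ε) n s x) (closedBall 0 (R i)))
    {ε : Idx m → ℂ} (hε : ∀ p, ‖ε p‖ < R p.1) :
    dividedDiffY m R lam α y n s ε * newtonMatrix ε = nfoldY (splitY m lam α y n s ε) := by
  ext x ⟨i, k⟩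
  have h := sum_dividedDiff_mul_prod (hR i) (hhol i x) (e := nodes ε i) k.2 fun l hl => by
    rw [nodes, dif_pos hl]
    exact hε _
  rw [nodes_val ε ⟨i, k⟩, Finset.sum_range] at h
  rw [Matrix.mul_apply, Fintype.sum_sigma, Finset.sum_eq_single i]
  · simpa [dividedDiffY, newtonMatrix, nfoldY, splitY, splitLam] using h
  · intro j _ hj
    simp [newtonMatrix, hj]
  · exact fun h => absurd (Finset.mem_univ i) h

theorem tendsto_splitFilter (p : Idx m) : Tendsto (fun ε => ε p) (splitFilter m) (𝓝 0) :=
  ((continuous_apply p).tendsto' 0 0 rfl).mono_left nhdsWithin_le_nhds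

theorem tendsto_nodes (i : Fin r) (l : ℕ) :
    Tendsto (fun ε => nodes ε i l) (splitFilter m) (𝓝 0) := by
  by_cases h : l < m i
  · simpa only [nodes, dif_pos h] using tendsto_splitFilter _
  · simpa only [nodes, dif_neg h] using tendsto_const_nhds

theorem tendsto_splitLam (lam α : Fin r → ℂ) (p : Idx m) :
    Tendsto (fun ε => splitLam m lam α ε p) (splitFilter m) (𝓝 (lam p.1)) := by
  simpa [splitLam] using ((tendsto_splitFilter p).const_mul (α p.1)).const_add (lam p.1)

theorem eventually_star_splitLam_ne (α : Fin r → ℂ) (hlam : ∀ i j, star (lam i) ≠ lam j) :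
    ∀ᶠ ε in splitFilter m, ∀ p p', star (splitLam m lam α ε p) ≠ splitLam m lam α ε p' := by
  simp only [eventually_all]
  intro p p'
  have h := (tendsto_splitLam lam α p).star.sub (tendsto_splitLam lam α p')
  filter_upwards [h.eventually_ne (sub_ne_zero.2 (hlam p.1 p'.1))] with ε hε
  exact sub_ne_zero.1 hε

theorem tendsto_jordan (lam α : Fin r → ℂ) :
    Tendsto (fun ε => jordan α (splitLam m lam α ε)) (splitFilter m)
      (𝓝 (jordan α fun p : Idx m => lam p.1)) := by
  refine Tendsto.add ?_ tendsto_const_nhds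
  refine ((continuous_id.matrix_diagonal).tendsto _).comp (tendsto_pi_nhds.2 fun p => ?_)
  exact tendsto_splitLam lam α p

theorem tendsto_matrix_inv {X ι : Type*} [Fintype ι] [DecidableEq ι] {l : Filter X}
    {F : X → Matrix ι ι ℂ} {A : Matrix ι ι ℂ} (hF : Tendsto F l (𝓝 A)) (hA : A.det ≠ 0) :
    Tendsto (fun ε => (F ε)⁻¹) l (𝓝 A⁻¹) := by
  refine (continuousAt_matrix_inv A ?_).tendsto.comp hF
  rw [Ring.inverse_eq_inv']
  exact continuousAt_inv₀ hA

theorem tendsto_matrix_mul {X k l n : Type*} [Fintype l] {f : Filter X}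
    {F : X → Matrix k l ℂ} {G : X → Matrix l n ℂ} {A : Matrix k l ℂ} {B : Matrix l n ℂ}
    (hF : Tendsto F f (𝓝 A)) (hG : Tendsto G f (𝓝 B)) :
    Tendsto (fun ε => F ε * G ε) f (𝓝 (A * B)) := by
  refine tendsto_pi_nhds.2 fun i => tendsto_pi_nhds.2 fun j => ?_
  simp only [Matrix.mul_apply]
  exact tendsto_finsetSum _ fun c _ => (tendsto_pi_nhds.1 (tendsto_pi_nhds.1 hF i) c).mul
    (tendsto_pi_nhds.1 (tendsto_pi_nhds.1 hG c) j)

/-- The generalized Darboux matrix is a limit of `N`-fold ones. -/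
theorem gen_limit (σ : ℝ) (m : Fin r → ℕ) (α : Fin r → ℂ)
    (hlam : ∀ i j, star (lam i) ≠ lam j) (hW : ∀ i, IsOpen (W i) ∧ lam i ∈ W i)
    (hhol : ∀ i n s, DifferentiableOn ℂ (fun z => y i z n s) (W i)) {n : ℤ} {s : ℝ}
    (hdet : (genM σ m lam α y n s).det ≠ 0) :
    (∀ᶠ ε in splitFilter m,
      (nfoldM σ (splitLam m lam α ε) (splitY m lam α y n s ε)).det ≠ 0) ∧
    ∀ z : ℂ, (∀ i, z ≠ star (lam i)) →
      Tendsto (fun ε => nfoldT σ (splitLam m lam α ε) (splitY m lam α y n s ε) z)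
        (splitFilter m) (𝓝 (genT σ m lam α y z n s)) := by
  -- Required by dominated convergence in `tendsto_dividedDiff`.
  have hcg : (splitFilter m).IsCountablyGenerated := by
    unfold splitFilter
    infer_instance
  choose R hR hRW using fun i => exists_radius (hW i).1 (hW i).2 (α i)
  have hol : ∀ i x, DifferentiableOn ℂ (fun ε => y i (lam i + α i * ε) n s x)
      (closedBall 0 (R i)) := fun i x =>
    differentiableOn_pi.1 (differentiableOn_family (hRW i) (hhol i) n s) x
  have hY : Tendsto (dividedDiffY m R lam α y n s) (splitFilter m) (𝓝 (genY m lam α y n s)) :=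
    tendsto_pi_nhds.2 fun x => tendsto_pi_nhds.2 fun p =>
      tendsto_dividedDiff (hR p.1) (hol p.1 x) (tendsto_nodes p.1) p.2
  have hYH : Tendsto (fun ε => (dividedDiffY m R lam α y n s ε)ᴴ) (splitFilter m)
      (𝓝 (genY m lam α y n s)ᴴ) :=
    (continuous_id.matrix_conjTranspose.tendsto _).comp hY
  have hsmall : ∀ᶠ ε in splitFilter m, ∀ p, ‖ε p‖ < R p.1 := by
    simp only [eventually_all]
    intro p
    have h := (tendsto_splitFilter p).norm
    rw [norm_zero] at h
    exact h.eventually_lt_const (hR p.1)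
  have hinj : ∀ᶠ ε in splitFilter m, IsUnit (newtonMatrix ε).det := by
    filter_upwards [self_mem_nhdsWithin] with ε hε
    exact isUnit_det_newtonMatrix hε
  have hfac : ∀ᶠ ε in splitFilter m, nfoldY (splitY m lam α y n s ε) =
      dividedDiffY m R lam α y n s ε * newtonMatrix ε :=
    hsmall.mono fun ε hε => (dividedDiffY_mul_newtonMatrix hR hol hε).symm
  -- The `N`-fold `M` in the basis of divided differences. It solves a bidiagonal Sylvester equation
  -- with convergent data, so it has a limit although the Newton matrix degenerates.
  let Md : (Idx m → ℂ) → Matrix (Idx m) (Idx m) ℂ := fun ε => ((newtonMatrix ε)ᴴ)⁻¹ *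
    nfoldM σ (splitLam m lam α ε) (splitY m lam α y n s ε) * (newtonMatrix ε)⁻¹
  have hM : Tendsto Md (splitFilter m) (𝓝 (genM σ m lam α y n s)) := by
    have hB : Tendsto (fun ε => (dividedDiffY m R lam α y n s ε)ᴴ * J σ *
        dividedDiffY m R lam α y n s ε) (splitFilter m)
        (𝓝 ((genY m lam α y n s)ᴴ * J σ * genY m lam α y n s)) :=
      tendsto_matrix_mul (tendsto_matrix_mul hYH tendsto_const_nhds) hY
    refine tendsto_pi_nhds.2 fun p => tendsto_pi_nhds.2 fun p' => ?_
    refine tendsto_sylvester_jordan (fun p p' => hlam p.1 p'.1) (tendsto_splitLam lam α)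
      (fun p p' => tendsto_pi_nhds.1 (tendsto_pi_nhds.1 hB p) p') ?_
      (gen_sylvester σ m α hlam hW hhol n s) p p'
    filter_upwards [hinj, hfac, eventually_star_splitLam_ne α hlam] with ε h1 h2 h3
    refine sylvester_congr h1 (jordan_mul_newtonMatrix α lam ε) ?_
    rw [← h2]
    exact nfold_sylvester σ h3 _
  have hMdet : ∀ᶠ ε in splitFilter m, (Md ε).det ≠ 0 :=
    ((continuous_id.matrix_det.tendsto _).comp hM).eventually_ne hdet
  refine ⟨?_, fun z hz => ?_⟩
  · filter_upwards [hMdet] with ε hε h0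
    exact hε (by simp [Md, det_mul, h0])
  · have hdetz : (z • 1 - (jordan α fun p : Idx m => lam p.1)ᴴ).det ≠ 0 := by
      have h := congrArg det (gen_resolvent (m := m) α hz)
      rw [det_mul, det_one] at h
      exact right_ne_zero_of_mul_eq_one h
    have hres : genDinv m lam α z = (z • 1 - (jordan α fun p : Idx m => lam p.1)ᴴ)⁻¹ :=
      (inv_eq_left_inv (gen_resolvent α hz)).symm
    have hJ : Tendsto (fun ε => (z • 1 - (jordan α (splitLam m lam α ε))ᴴ)⁻¹) (splitFilter m)
        (𝓝 (genDinv m lam α z)) := by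
      rw [hres]
      refine tendsto_matrix_inv (tendsto_const_nhds.sub ?_) hdetz
      exact (continuous_id.matrix_conjTranspose.tendsto _).comp (tendsto_jordan lam α)
    have hlim : Tendsto (fun ε => 1 + dividedDiffY m R lam α y n s ε * (Md ε)⁻¹ *
        (z • 1 - (jordan α (splitLam m lam α ε))ᴴ)⁻¹ * (dividedDiffY m R lam α y n s ε)ᴴ * J σ)
        (splitFilter m) (𝓝 (genT σ m lam α y z n s)) :=
      tendsto_const_nhds.add (tendsto_matrix_mul (tendsto_matrix_mul (tendsto_matrix_mul
        (tendsto_matrix_mul hY (tendsto_matrix_inv hM hdet)) hJ) hYH) tendsto_const_nhds)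
    refine hlim.congr' ?_
    filter_upwards [hinj, hfac] with ε h1 h2
    have hD : (z • 1 - (diagonal (splitLam m lam α ε))ᴴ) =
        diagonal fun p => z - star (splitLam m lam α ε p) := by
      rw [diagonal_conjTranspose, smul_one_eq_diagonal, diagonal_sub]
      rfl
    rw [nfoldT, h2, ← hD, dressing_congr z h1 (jordan_mul_newtonMatrix α lam ε)]

end CoalescenceLimit

end SemiDiscreteCSP

end

/-! ### The theorem -/

open SemiDiscreteCSP in
theorem proposition2 (a : ℝ) (ha : a ≠ 0) (σ : ℝ) (hσ : σ = 1 ∨ σ = -1)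
    (ρ : ℤ → ℝ → ℝ) (q : ℤ → ℝ → ℂ)
    (hq : ∀ n, Differentiable ℝ (q n))
    (hsol : ∀ n s, SolvesAt a σ ρ q n s) :
    -- the `N`-fold Darboux transformation
    (∀ (N : ℕ) (lam : Fin N → ℂ) (y : Fin N → ℤ → ℝ → Fin 2 → ℂ),
      (∀ i j, star (lam i) ≠ lam j) →
      (∀ i, IsLaxSolution a σ ρ q (lam i) (y i)) →
      ∃ (ρN : ℤ → ℝ → ℝ) (qN : ℤ → ℝ → ℂ),
        IsDarbouxMatrix a σ ρ q ρN qN {z | ∃ i, z = star (lam i)}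
          (fun n s => (nfoldM σ lam fun i => y i n s).det)
          (fun z n s => nfoldT σ lam (fun i => y i n s) z) ∧
        BacklundFormulas a σ ρ q ρN qN
          (fun n s => (nfoldM σ lam fun i => y i n s).det)
          (fun n s =>
            (matG (nfoldY fun i => y i n s) (nfoldM σ lam fun i => y i n s)).det) ∧
        SolvesAgain a σ ρN qN (fun n s => (nfoldM σ lam fun i => y i n s).det)) ∧
    -- the generalized Darboux transformation
    (∀ (r : ℕ) (m : Fin r → ℕ) (lam α : Fin r → ℂ) (W : Fin r → Set ℂ)
      (y : Fin r → ℂ → ℤ → ℝ → Fin 2 → ℂ),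
      (∀ i j, star (lam i) ≠ lam j) →
      (∀ i, IsOpen (W i) ∧ lam i ∈ W i) →
      (∀ i n s, DifferentiableOn ℂ (fun z => y i z n s) (W i)) →
      (∀ i, ∀ z ∈ W i, IsLaxSolution a σ ρ q z (y i z)) →
      (∃ (ρN : ℤ → ℝ → ℝ) (qN : ℤ → ℝ → ℂ),
        IsDarbouxMatrix a σ ρ q ρN qN {z | ∃ i, z = star (lam i)}
          (fun n s => (genM σ m lam α y n s).det)
          (fun z n s => genT σ m lam α y z n s) ∧
        BacklundFormulas a σ ρ q ρN qN
          (fun n s => (genM σ m lam α y n s).det)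
          (fun n s => (matG (genY m lam α y n s) (genM σ m lam α y n s)).det) ∧
        SolvesAgain a σ ρN qN (fun n s => (genM σ m lam α y n s).det)) ∧
      -- it is the limit of `N`-fold ones as the spectral points in each group coalesce
      (∀ (n : ℤ) (s : ℝ), (genM σ m lam α y n s).det ≠ 0 →
        (∀ᶠ ε in splitFilter m,
          (nfoldM σ (splitLam m lam α ε) (splitY m lam α y n s ε)).det ≠ 0) ∧
        ∀ z : ℂ, (∀ i, z ≠ star (lam i)) → ∀ x x' : Fin 2,
          Tendsto
            (fun ε => nfoldT σ (splitLam m lam α ε) (splitY m lam α y n s ε) z x x')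
            (splitFilter m) (𝓝 (genT σ m lam α y z n s x x')))) := by

  have hσ' : σ * σ = 1 := by rcases hσ with rfl | rfl <;> norm_num
  refine ⟨fun N lam y hlam hy => ?_, fun r m lam α W y hlam hW hhol hy => ⟨?_, fun n s hdet => ?_⟩⟩
  · exact (nfold_isDressing hlam hy).exists_darboux ha hσ' hq hsol
      (R := fun z => (Matrix.diagonal fun p => z - star (lam p))⁻¹)
      fun z hz => nfold_resolvent fun i hi => hz ⟨i, hi⟩
  · exact (gen_isDressing α m hq hlam hW hhol hy).exists_darboux ha hσ' hq hsol
      (R := fun z => genDinv m lam α z) fun z hz => gen_resolvent α fun i hi => hz ⟨i, hi⟩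
  · obtain ⟨h1, h2⟩ := gen_limit σ m α hlam hW hhol hdet
    exact ⟨h1, fun z hz x x' => tendsto_pi_nhds.1 (tendsto_pi_nhds.1 (h2 z hz) x) x'⟩
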